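/- Let $\mathbf{k}$ be a field. A persistence $\mathbf{k}$-module is a functor $V:(\mathbb{R},\le)\to \mathrm{Vect}_{\mathbf{k}}$ with all $V_t$ finite dimensional and with locally finite spectrum, the spectrum being the set of $t\in\mathbb{R}$ that have no neighbourhood $U$ such that $V_s\to V_r$ is an isomorphism for all $s\le r$ in $U$. A constructible sheaf on $\mathbb{R}$ is a sheaf of $\mathbf{k}$-vector spaces with finite dimensional stalks which is locally constant off some locally finite subset of $\mathbb{R}$. For a nonempty interval $I\subseteq\mathbb{R}$ let $\mathbb{I}_I$ be the interval module ($\mathbf{k}$ at $t\in I$ and $0$ elsewhere, with identity transfer maps inside $I$ and zero transfer maps otherwise), and let $\mathbf{k}_I$ be the constant sheaf on $I$ extended by zero. A collection $\mathcal{B}$ of intervals with multiplicities $m_I$ is a barcode of $V$ (respectively of a sheaf $\mathcal{F}$) if $V\cong\bigoplus_I \mathbb{I}_I^{m_I}$ (respectively $\mathcal{F}\cong\bigoplus_I \mathbf{k}_I^{m_I}$). Such an object is of $(-,-]$-type if it has a barcode all of whose bars are of the form $(a,b]=\{t\in\mathbb{R} : a<t\le b\}$ with $-\infty\le a<b\le+\infty$.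 Let $\mathcal{P}$ be the category of persistence $\mathbf{k}$-modules of $(-,-]$-type, with natural transformations as morphisms, and let $\mathrm{Sh}_c(\mathbb{R})$ be the category of constructible sheaves on $\mathbb{R}$ of $(-,-]$-type, a full subcategory of the category of sheaves of $\mathbf{k}$-vector spaces. Let $\mathbb{R}_A$ be $\mathbb{R}$ with the Alexandrov topology (open sets: $\emptyset$, $\mathbb{R}$, $[a,\infty)$, $(b,\infty)$), let $\mathbb{R}_\gamma$ be $\mathbb{R}$ with the $\gamma$-topology (open sets: $\emptyset$, $\mathbb{R}$, $(a,\infty)$), and let $\phi:\mathbb{R}_A\to\mathbb{R}_\gamma$ and $\psi:\mathbb{R}\to\mathbb{R}_\gamma$ be the identity maps. For a functor $V:(\mathbb{R},\le)\to \mathrm{Vect}_{\mathbf{k}}$ let $V_A$ be the sheaf on $\mathbb{R}_A$ with $V_A(U)=\varprojlim_{t\in U}V_t$, so that $V_A([a,\infty))=V_a$ and $V_A((b,\infty))=\varprojlim_{t>b}V_t$. Put $$\Phi(V)=\psi^{-1}\phi_*V_A,\qquad \Psi(\mathcal{F})_a=(\phi^{-1}\psi_*\mathcal{F})([a,\infty)),$$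 with the evident action on morphisms and, for $\Psi(\mathcal{F})$, the restriction maps as transfer maps. Then $\Phi$ maps $\mathcal{P}$ to $\mathrm{Sh}_c(\mathbb{R})$, $\Psi$ maps $\mathrm{Sh}_c(\mathbb{R})$ to $\mathcal{P}$, and $\Phi:\mathcal{P}\to\mathrm{Sh}_c(\mathbb{R})$ is an equivalence of categories with inverse $\Psi$. Moreover it preserves barcodes: for every $V\in\mathcal{P}$, the barcodes of $V$ are exactly the barcodes of $\Phi(V)$, and for every $\mathcal{F}\in\mathrm{Sh}_c(\mathbb{R})$, the barcodes of $\Psi(\mathcal{F})$ are exactly the barcodes of $\mathcal{F}$. -/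

import Mathlib

open CategoryTheory CategoryTheory.Limits TopologicalSpace Topology Opposite

noncomputable section

namespace PersistenceSheaf

/-! ### The three topologies on the real line -/

/-- The real line with the `γ`-topology for the cone `γ = [0, ∞)`. -/
def GammaReal : Type := ℝ

namespace GammaReal

/-- The identity map from the real line to the real line with the `γ`-topology. -/
def ofReal (x : ℝ) : GammaReal := x

/-- The open sets are the usual open sets `U` with `U + [0, ∞) = U`, that is, the open rays
`(a, ∞)` together with the empty set and the whole line. -/
instance : TopologicalSpace GammaReal where
  IsOpen U := IsOpen (ofReal ⁻¹' U) ∧ IsUpperSet (ofReal ⁻¹' U)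
  isOpen_univ := ⟨isOpen_univ, isUpperSet_univ⟩
  isOpen_inter _ _ hs ht := ⟨hs.1.inter ht.1, hs.2.inter ht.2⟩
  isOpen_sUnion s hs := by
    rw [Set.preimage_sUnion]
    exact ⟨isOpen_biUnion fun t ht => (hs t ht).1, isUpperSet_iUnion₂ fun t ht => (hs t ht).2⟩

end GammaReal

/-- The real line with the Alexandrov topology, whose open sets are the upper sets: the rays
`[a, ∞)` and `(b, ∞)`, the empty set and the whole line. -/
abbrev AlexReal : TopCat.{0} := TopCat.of (WithUpperSet ℝ)

/-- The identity map from the Alexandrov topology to the `γ`-topology. -/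
def phi : AlexReal ⟶ TopCat.of GammaReal :=
  TopCat.ofHom ⟨fun x => GammaReal.ofReal (WithUpperSet.ofUpperSet x),
    ⟨fun _ hU => hU.2⟩⟩

/-- The identity map from the usual topology to the `γ`-topology. -/
def psi : TopCat.of ℝ ⟶ TopCat.of GammaReal :=
  TopCat.ofHom ⟨GammaReal.ofReal, ⟨fun _ hU => hU.1⟩⟩

/-! ### The functors -/

section Functors

variable (k : Type) [Field k]

/-- The sheaf on the Alexandrov line attached to a functor `V` on `(ℝ, ≤)`: the right Kan extension
of `V` along `a ↦ [a, ∞)`, so that the sections over `U` are `lim_{t ∈ U} V_t`. In particular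
`[a, ∞)` has sections `V_a` and `(b, ∞)` has sections `lim_{t > b} V_t`. -/
def toAlexSheaf : (ℝ ⥤ ModuleCat.{0} k) ⥤ TopCat.Sheaf (ModuleCat.{0} k) AlexReal :=
  (Functor.whiskeringLeft _ _ _).obj WithUpperSet.ofUpperSetOrderIso.monotone.functor ⋙
    ObjectProperty.lift _ (Alexandrov.principals (WithUpperSet ℝ)).ran fun V =>
      IsUpperSet.isSheaf_of_isRightKanExtension V _
        ((Alexandrov.principals (WithUpperSet ℝ)).ranCounit.app V)

/-- The functor on `(ℝ, ≤)` attached to a sheaf `F` on the Alexandrov line: `a ↦ F([a, ∞))`. -/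
def ofAlexSheaf : TopCat.Sheaf (ModuleCat.{0} k) AlexReal ⥤ (ℝ ⥤ ModuleCat.{0} k) :=
  TopCat.Sheaf.forget _ _ ⋙
    (Functor.whiskeringLeft _ _ _).obj
      (WithUpperSet.toUpperSetOrderIso.monotone.functor ⋙
        Alexandrov.principals (WithUpperSet ℝ))

/-- `Φ V = ψ⁻¹ φ_* F`, where `F` is the Alexandrov sheaf of `V`. -/
def Phi : (ℝ ⥤ ModuleCat.{0} k) ⥤ TopCat.Sheaf (ModuleCat.{0} k) (TopCat.of ℝ) :=
  toAlexSheaf k ⋙ TopCat.Sheaf.pushforward (ModuleCat.{0} k) phi ⋙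
    TopCat.Sheaf.pullback (ModuleCat.{0} k) psi

/-- `Ψ F` is the functor on `(ℝ, ≤)` attached to the Alexandrov sheaf `φ⁻¹ ψ_* F`. -/
def Psi : TopCat.Sheaf (ModuleCat.{0} k) (TopCat.of ℝ) ⥤ (ℝ ⥤ ModuleCat.{0} k) :=
  TopCat.Sheaf.pushforward (ModuleCat.{0} k) psi ⋙
    TopCat.Sheaf.pullback (ModuleCat.{0} k) phi ⋙ ofAlexSheaf k

end Functors

/-! ### Bars and barcodes -/

/-- A bar is a nonempty interval of the real line, of any kind. -/
abbrev Bar : Type := {I : Set ℝ // I.Nonempty ∧ I.OrdConnected}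

/-- A bar of the form `(a, b]`, where `a = -∞` and `b = +∞` are allowed. -/
def Bar.IsLeftOpenRightClosed (I : Bar) : Prop :=
  ∃ a b : EReal, (I : Set ℝ) = {t : ℝ | a < (t : EReal) ∧ (t : EReal) ≤ b}

/-- A collection of bars with multiplicities. -/
abbrev Barcode : Type := Bar → ℕ

section Bars

variable (k : Type) [Field k]

/-- The value at `t` of the interval module: `k` if `t ∈ I`, and `0` otherwise. -/
def intervalValue (I : Bar) (t : ℝ) : Submodule k k where
  carrier := {x | t ∉ (I : Set ℝ) → x = 0}
  add_mem' ha hb h := by simp [ha h, hb h]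
  zero_mem' _ := rfl
  smul_mem' c x hx h := by simp [hx h]

open Classical in
/-- The transfer map of the interval module: the identity of `k` if both parameters lie in `I`,
and `0` otherwise. -/
def intervalTransfer (I : Bar) (s t : ℝ) : intervalValue k I s →ₗ[k] intervalValue k I t where
  toFun x := ⟨if t ∈ (I : Set ℝ) then x else 0, fun h => if_neg h⟩
  map_add' x y := by
    apply Subtype.ext
    by_cases h : t ∈ (I : Set ℝ) <;> simp [h]
  map_smul' c x := by
    apply Subtype.ext
    by_cases h : t ∈ (I : Set ℝ) <;> simp [h]

open Classical in
/-- The interval-type persistence module of `I`. -/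
def intervalModule (I : Bar) : ℝ ⥤ ModuleCat.{0} k where
  obj t := ModuleCat.of k (intervalValue k I t)
  map {s t} _ := ModuleCat.ofHom (intervalTransfer k I s t)
  map_id t := by
    refine ModuleCat.hom_ext (LinearMap.ext fun x => Subtype.ext ?_)
    change (if t ∈ (I : Set ℝ) then (x.1 : k) else 0) = x.1
    by_cases h : t ∈ (I : Set ℝ)
    · exact if_pos h
    · rw [if_neg h, x.2 h]
  map_comp {s t r} f g := by
    refine ModuleCat.hom_ext (LinearMap.ext fun x => Subtype.ext ?_)
    change (if r ∈ (I : Set ℝ) then (x.1 : k) else 0) =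
      if r ∈ (I : Set ℝ) then (if t ∈ (I : Set ℝ) then (x.1 : k) else 0) else 0
    by_cases hr : r ∈ (I : Set ℝ)
    · by_cases ht : t ∈ (I : Set ℝ)
      · simp [hr, ht]
      · have hs : s ∉ (I : Set ℝ) := fun hs => ht (I.2.2.out hs hr ⟨f.le, g.le⟩)
        simp [hr, ht, x.2 hs]
    · simp [hr]

/-- Sections over `U` of `k_I`, the constant sheaf on the interval `I` extended by zero: functions
on `U` which vanish off `I`, and near every point `x` of `U` are constant on `I` with the
value they take at `x`. (So the support in `U` is closed in `U`.) -/
def intervalSections (I : Bar) (U : Opens ℝ) : Submodule k (U → k) where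
  carrier := {f | ∀ x : U, ((x : ℝ) ∉ (I : Set ℝ) → f x = 0) ∧
    ∀ᶠ y : U in 𝓝 x, (y : ℝ) ∈ (I : Set ℝ) → f y = f x}
  add_mem' {f g} hf hg x := by
    refine ⟨fun h => by simp [(hf x).1 h, (hg x).1 h], ?_⟩
    filter_upwards [(hf x).2, (hg x).2] with y h₁ h₂ h
    simp [h₁ h, h₂ h]
  zero_mem' x := ⟨fun _ => rfl, by simp⟩
  smul_mem' c f hf x := by
    refine ⟨fun h => by simp [(hf x).1 h], ?_⟩
    filter_upwards [(hf x).2] with y h₁ h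
    simp [h₁ h]

/-- Restriction of sections of `k_I`. -/
def intervalRestrict (I : Bar) {U W : Opens ℝ} (h : W ≤ U) :
    intervalSections k I U →ₗ[k] intervalSections k I W where
  toFun f := ⟨fun x => f.1 ⟨x, h x.2⟩, fun x => ⟨fun hx => (f.2 ⟨x, h x.2⟩).1 hx,
    (continuous_inclusion h).continuousAt.eventually (f.2 ⟨x, h x.2⟩).2⟩⟩
  map_add' _ _ := rfl
  map_smul' _ _ := rfl

/-- The underlying presheaf of `k_I`. -/
def intervalPresheaf (I : Bar) : TopCat.Presheaf (ModuleCat.{0} k) (TopCat.of ℝ) where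
  obj U := ModuleCat.of k (intervalSections k I U.unop)
  map f := ModuleCat.ofHom (intervalRestrict k I f.unop.le)

theorem intervalPresheaf_isSheaf (I : Bar) : (intervalPresheaf k I).IsSheaf := by
  rw [TopCat.Presheaf.isSheaf_iff_isSheafUniqueGluing]
  intro ι U sf hsf
  have hval : ∀ (i j : ι) (x : ℝ) (hi : x ∈ U i) (hj : x ∈ U j),
      (sf i).1 ⟨x, hi⟩ = (sf j).1 ⟨x, hj⟩ := fun i j x hi hj =>
    congrFun (congrArg Subtype.val (hsf i j)) ⟨x, hi, hj⟩
  have hmem : ∀ x : (iSup U : Opens ℝ), ∃ i, (x : ℝ) ∈ U i := fun x => Opens.mem_iSup.1 x.2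
  choose c hc using hmem
  refine ⟨⟨fun x => (sf (c x)).1 ⟨x, hc x⟩, fun x => ⟨fun hx => ((sf (c x)).2 _).1 hx, ?_⟩⟩, ?_, ?_⟩
  · have h := ((sf (c x)).2 ⟨x, hc x⟩).2
    rw [nhds_subtype, Filter.eventually_comap] at h ⊢
    filter_upwards [h, (U (c x)).isOpen.mem_nhds (hc x)] with y hy hyU z hz hzI
    subst hz
    exact (hval _ _ _ _ hyU).trans (hy ⟨z, hyU⟩ rfl hzI)
  · intro i
    exact Subtype.ext (funext fun x => hval _ _ _ _ _)
  · intro t ht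
    exact Subtype.ext (funext fun x => congrFun (congrArg Subtype.val (ht (c x))) ⟨x, hc x⟩)

/-- The sheaf `k_I` on the real line. -/
def intervalSheaf (I : Bar) : TopCat.Sheaf (ModuleCat.{0} k) (TopCat.of ℝ) :=
  ⟨intervalPresheaf k I, intervalPresheaf_isSheaf k I⟩

variable {k}

/-- `B` is a barcode of `V`: `V` is the direct sum of the interval modules of the bars in `B`,
counted with multiplicity. -/
def HasBarcode (V : ℝ ⥤ ModuleCat.{0} k) (B : Barcode) : Prop :=
  Nonempty (V ≅ ∐ fun p : Σ I : Bar, Fin (B I) => intervalModule k p.1)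

/-- `B` is a barcode of the sheaf `F`: `F` is the direct sum of the sheaves `k_I` of the bars
in `B`, counted with multiplicity. -/
def HasSheafBarcode (F : TopCat.Sheaf (ModuleCat.{0} k) (TopCat.of ℝ)) (B : Barcode) : Prop :=
  Nonempty (F ≅ ∐ fun p : Σ I : Bar, Fin (B I) => intervalSheaf k p.1)

end Bars

/-! ### The two categories -/

section Categories

variable {k : Type} [Field k]

/-- A subset of the real line with finitely many points in every bounded interval. -/
def IsLocallyFiniteSet (S : Set ℝ) : Prop :=
  ∀ a b : ℝ, (S ∩ Set.Icc a b).Finite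

/-- The spectrum of `V`: the points without a neighbourhood in which all transfer maps are
isomorphisms. -/
def spectrum (V : ℝ ⥤ ModuleCat.{0} k) : Set ℝ :=
  {t | ¬ ∃ U ∈ 𝓝 t, ∀ s ∈ U, ∀ r ∈ U, ∀ h : s ≤ r, IsIso (V.map (homOfLE h))}

/-- A persistence module: finite dimensional at every parameter, with locally finite spectrum. -/
structure IsPersistenceModule (V : ℝ ⥤ ModuleCat.{0} k) : Prop where
  finite : ∀ t : ℝ, Module.Finite k (V.obj t)
  regular : IsLocallyFiniteSet (spectrum V)

/-- A constructible sheaf: the stalks are finite dimensional, and the sheaf is locally constant off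
a locally finite set of points. A sheaf is constant near `x` if `x` has an open neighbourhood `U`
whose sections map isomorphically to the stalks at all points of `U`. -/
structure IsConstructible (F : TopCat.Sheaf (ModuleCat.{0} k) (TopCat.of ℝ)) : Prop where
  finite : ∀ x : ℝ, Module.Finite k (F.presheaf.stalk x)
  locallyConstant : ∃ S : Set ℝ, IsLocallyFiniteSet S ∧ ∀ x : ℝ, x ∉ S →
    ∃ U : Opens ℝ, x ∈ U ∧ ∀ (y : ℝ) (hy : y ∈ U), IsIso (F.presheaf.germ U y hy)

variable (k)

/-- Persistence modules of `(-,-]` type. -/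
def persistenceModules : ObjectProperty (ℝ ⥤ ModuleCat.{0} k) := fun V =>
  IsPersistenceModule V ∧
    ∃ B : Barcode, HasBarcode V B ∧ ∀ I, B I ≠ 0 → I.IsLeftOpenRightClosed

/-- Constructible sheaves on the real line of `(-,-]` type. -/
def constructibleSheaves : ObjectProperty (TopCat.Sheaf (ModuleCat.{0} k) (TopCat.of ℝ)) :=
  fun F => IsConstructible F ∧
    ∃ B : Barcode, HasSheafBarcode F B ∧ ∀ I, B I ≠ 0 → I.IsLeftOpenRightClosed

end Categories

end PersistenceSheaf

end

/-! Both functors pass through sheaves on $\mathbb{R}_\gamma$. Write $L \dashv R$ for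
`gammaAdjunction`, where $L$ is `ofGammaSheaf` and $R$ is `toGammaSheaf`. Then $\Phi = \psi^{-1}R$
and $\Psi = L\psi_*$. The units of $L \dashv R$ and of $\psi^{-1} \dashv \psi_*$ are invertible
(`isIso_gammaAdjunction_unit`, `isIso_psi_unit`), so $\gamma$-sheaves embed fully faithfully both
into functors and into sheaves on $\mathbb{R}$. Hence $\Psi\Phi V \cong LRV \to V$ and $\Phi\Psi F
\cong \psi^{-1}\psi_*F \to F$, and everything reduces to the invertibility of the two counits.

For an interval module and for an interval sheaf, the counit is invertible exactly when the bar is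
of the form $(a,b]$: elements must extend a little to the left, and vanishing must spread a little
to the left (`isIso_counit_intervalModule_iff`, `isLeftContinuous_of_isIso_psiCounit`,
`Bar.IsLeftContinuous.isIso_psiCounit`). For such a bar both objects come from the same
$\gamma$-sheaf (`isIso_comparison`). Left adjoints preserve coproducts, so $\Phi$ and $\Psi$ carry
sums of such bars to the corresponding sums.

Every barcode has to be transported, not only one of the right type. A bar of $V$ is a retract of
$V$, and invertibility of the counit passes to retracts, so every barcode of an object of either
category consists of bars $(a,b]$; uniqueness of decompositions is not needed. Finally, stalks of
$\psi^{-1}G$ are values of $LG$, which matches constructibility with finite dimension and locally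
finite spectrum. -/

noncomputable section

namespace PersistenceSheaf

/-! ### Sections, restrictions and germs -/

section Germs

variable {k : Type} [Field k] {X Y : TopCat.{0}}

/-- Sections of a sheaf over an open set. -/
abbrev Sec (F : X.Sheaf (ModuleCat.{0} k)) (U : Opens X) : Type := F.1.obj (op U)

/-- The stalk of a sheaf at a point. -/
abbrev Stalk (F : X.Sheaf (ModuleCat.{0} k)) (x : X) : ModuleCat.{0} k := F.presheaf.stalk x

/-- Restriction of sections, as a linear map. -/
def res (F : X.Sheaf (ModuleCat.{0} k)) {U V : Opens X} (h : V ≤ U) : Sec F U →ₗ[k] Sec F V :=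
  (F.1.map (homOfLE h).op).hom

/-- The germ of a section at a point, as a linear map. -/
def germ (F : X.Sheaf (ModuleCat.{0} k)) (U : Opens X) (x : X) (hx : x ∈ U) :
    Sec F U →ₗ[k] Stalk F x :=
  (F.presheaf.germ U x hx).hom

variable (F : X.Sheaf (ModuleCat.{0} k))

lemma germ_res {U V : Opens X} (h : V ≤ U) (x : X) (hx : x ∈ V) (s : Sec F U) :
    germ F V x hx (res F h s) = germ F U x (h hx) s :=
  TopCat.Presheaf.germ_res_apply F.presheaf (homOfLE h) x hx s

lemma exists_germ_eq (x : X) (a : Stalk F x) :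
    ∃ (U : Opens X) (hx : x ∈ U) (s : Sec F U), germ F U x hx s = a :=
  TopCat.Presheaf.exists_germ_eq F.presheaf a

lemma eventually_germ_eq {U V : Opens X} (x : X) (hU : x ∈ U) (hV : x ∈ V) (s : Sec F U)
    (t : Sec F V) (h : germ F U x hU s = germ F V x hV t) :
    ∃ W : Opens X, x ∈ W ∧ ∃ (h₁ : W ≤ U) (h₂ : W ≤ V), res F h₁ s = res F h₂ t := by
  obtain ⟨W, hxW, i, j, h⟩ := TopCat.Presheaf.germ_eq F.presheaf x hU hV s t h
  exact ⟨W, hxW, i.le, j.le, h⟩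

lemma germ_eq_of_res_eq {U V W : Opens X} {s : Sec F U} {t : Sec F V} (h₁ : W ≤ U) (h₂ : W ≤ V)
    (h : res F h₁ s = res F h₂ t) (x : X) (hx : x ∈ W) :
    germ F U x (h₁ hx) s = germ F V x (h₂ hx) t := by
  rw [← germ_res F h₁ x hx, ← germ_res F h₂ x hx, h]

lemma section_ext {U : Opens X} (s t : Sec F U)
    (h : ∀ (x : X) (hx : x ∈ U), germ F U x hx s = germ F U x hx t) : s = t :=
  TopCat.Presheaf.section_ext F U s t h

lemma exists_glue (U : Opens X) {ι : Type} (V : ι → Opens X) (hV : ∀ i, V i ≤ U)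
    (hc : ∀ x ∈ U, ∃ i, x ∈ V i) (s : ∀ i, Sec F (V i))
    (h : ∀ i j (x : X) (hi : x ∈ V i) (hj : x ∈ V j),
      germ F (V i) x hi (s i) = germ F (V j) x hj (s j)) :
    ∃ t : Sec F U, ∀ i (x : X) (hi : x ∈ V i), germ F U x (hV i hi) t = germ F (V i) x hi (s i) := by
  obtain ⟨t, ht, -⟩ := TopCat.Sheaf.existsUnique_gluing' F V U (fun i => homOfLE (hV i))
    (fun x hx => Opens.mem_iSup.2 (hc x hx)) s (fun i j => section_ext F (U := V i ⊓ V j) _ _ fun x hx =>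
      (germ_res F inf_le_left x hx (s i)).trans
        ((h i j x hx.1 hx.2).trans (germ_res F inf_le_right x hx (s j)).symm))
  refine ⟨t, fun i x hi => ?_⟩
  rw [← germ_res F (hV i) x hi]
  exact congrArg (germ F (V i) x hi) (ht i)

/-- The map induced by a morphism of sheaves on sections, as a linear map. -/
def secMap {F G : X.Sheaf (ModuleCat.{0} k)} (a : F ⟶ G) (U : Opens X) : Sec F U →ₗ[k] Sec G U :=
  (a.1.app (op U)).hom

/-- The map induced by a morphism of sheaves on stalks, as a linear map. -/
def stalkMap {F G : X.Sheaf (ModuleCat.{0} k)} (a : F ⟶ G) (x : X) : Stalk F x →ₗ[k] Stalk G x :=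
  ((TopCat.Presheaf.stalkFunctor _ x).map a.1).hom

lemma stalkMap_germ {F G : X.Sheaf (ModuleCat.{0} k)} (a : F ⟶ G) (U : Opens X) (x : X) (hx : x ∈ U)
    (s : Sec F U) : stalkMap a x (germ F U x hx s) = germ G U x hx (secMap a U s) :=
  TopCat.Presheaf.stalkFunctor_map_germ_apply U x hx a.1 s

lemma secMap_res {F G : X.Sheaf (ModuleCat.{0} k)} (a : F ⟶ G) {U V : Opens X} (h : V ≤ U)
    (s : Sec F U) : secMap a V (res F h s) = res G h (secMap a U s) :=
  NatTrans.naturality_apply a.1 (homOfLE h).op s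

lemma isIso_of_secMap_bijective {F G : X.Sheaf (ModuleCat.{0} k)} (a : F ⟶ G)
    (h : ∀ U, Function.Bijective (secMap a U)) : IsIso a := by
  have : ∀ U, IsIso (a.1.app U) := fun U => (ConcreteCategory.isIso_iff_bijective _).2 (h U.unop)
  have : IsIso a.1 := NatIso.isIso_of_isIso_app _
  exact (isIso_iff_of_reflects_iso a (TopCat.Sheaf.forget _ _)).1 this

lemma isIso_of_stalkMap_bijective {F G : X.Sheaf (ModuleCat.{0} k)} (a : F ⟶ G)
    (h : ∀ x, Function.Bijective (stalkMap a x)) : IsIso a := by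
  have : ∀ x, IsIso ((TopCat.Presheaf.stalkFunctor (ModuleCat.{0} k) x).map a.1) := fun x =>
    (ConcreteCategory.isIso_iff_bijective _).2 (h x)
  exact TopCat.Presheaf.isIso_of_stalkFunctor_map_iso a

lemma secMap_bijective {F G : X.Sheaf (ModuleCat.{0} k)} (a : F ⟶ G) [IsIso a] (U : Opens X) :
    Function.Bijective (secMap a U) := by
  have : IsIso a.1 := inferInstanceAs (IsIso ((TopCat.Sheaf.forget _ _).map a))
  exact (ConcreteCategory.isIso_iff_bijective (a.1.app (op U))).1 inferInstance

lemma stalkMap_bijective {F G : X.Sheaf (ModuleCat.{0} k)} (a : F ⟶ G) [IsIso a] (x : X) :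
    Function.Bijective (stalkMap a x) := by
  have : IsIso a.1 := inferInstanceAs (IsIso ((TopCat.Sheaf.forget _ _).map a))
  exact (ConcreteCategory.isIso_iff_bijective
    ((TopCat.Presheaf.stalkFunctor (ModuleCat.{0} k) x).map a.1)).1 inferInstance

end Germs

/-! ### Stalks of inverse images -/

section InverseImage

variable (k : Type) [Field k] {X Y : TopCat.{0}} (f : X ⟶ Y)

-- The explicit inverse image comes from a composite of two adjunctions, so its unit is the
-- composite of theirs. This reduces stalks of the inverse image to stalks of a presheaf inverse
-- image.
open TopCat Functor in
lemma sheafPullbackConstruction_unit (G : Y.Sheaf (ModuleCat.{0} k)) :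
    ((sheafPullbackConstruction.sheafAdjunctionContinuous (Opens.map f) (ModuleCat k)
      (Opens.grothendieckTopology Y) (Opens.grothendieckTopology X)).unit.app G).hom =
      (Presheaf.pullbackPushforwardAdjunction (ModuleCat k) f).unit.app G.1 ≫
        (Presheaf.pushforward _ f).map (toSheafify (Opens.grothendieckTopology X) _) := by
  have h := Adjunction.map_restrictFullyFaithful_unit_app
    (((Opens.map f).op.lanAdjunction (ModuleCat k)).comp
      (sheafificationAdjunction (Opens.grothendieckTopology X) (ModuleCat k)))
    (fullyFaithfulSheafToPresheaf (Opens.grothendieckTopology Y) (ModuleCat.{0} k))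
    (FullyFaithful.id _)
    (L := sheafPullbackConstruction.sheafPullback (Opens.map f) (ModuleCat k)
      (Opens.grothendieckTopology Y) (Opens.grothendieckTopology X))
    (R := (Opens.map f).sheafPushforwardContinuous (ModuleCat k)
      (Opens.grothendieckTopology Y) (Opens.grothendieckTopology X))
    (Iso.refl _) (Iso.refl _) G
  refine h.trans ?_
  rw [Adjunction.comp_unit_app]
  simp
  rfl

open TopCat Functor in
/-- The inverse image of a sheaf is the sheafification of its inverse image as a presheaf,
compatibly with the adjunction units. -/
lemma exists_iso_sheafify_pullback (G : Y.Sheaf (ModuleCat.{0} k)) :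
    ∃ θ : (presheafToSheaf (Opens.grothendieckTopology X) (ModuleCat k)).obj
        ((Presheaf.pullback (ModuleCat k) f).obj G.1) ≅ (Sheaf.pullback (ModuleCat k) f).obj G,
      ((Sheaf.pullbackPushforwardAdjunction (ModuleCat k) f).unit.app G).1 =
        (Presheaf.pullbackPushforwardAdjunction (ModuleCat k) f).unit.app G.1 ≫
          (Presheaf.pushforward _ f).map
            (toSheafify (Opens.grothendieckTopology X) _ ≫ θ.hom.1) := by
  let θ := ((sheafPullbackConstruction.sheafPullbackIso (Opens.map f) (ModuleCat k)
    (Opens.grothendieckTopology Y) (Opens.grothendieckTopology X)).app G).symm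
  refine ⟨θ, ?_⟩
  have h := Adjunction.unit_leftAdjointUniq_hom_app
    (sheafPullbackConstruction.sheafAdjunctionContinuous (Opens.map f) (ModuleCat k)
      (Opens.grothendieckTopology Y) (Opens.grothendieckTopology X))
    (sheafAdjunctionContinuous (Opens.map f) (ModuleCat k)
      (Opens.grothendieckTopology Y) (Opens.grothendieckTopology X)) G
  refine (congrArg (fun z => z.1) h).symm.trans ?_
  rw [Functor.map_comp, ← Category.assoc]
  exact congrArg (· ≫ (Presheaf.pushforward (ModuleCat k) f).map θ.hom.1)
    (sheafPullbackConstruction_unit k f G)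

/-- The map to the sheafification is locally injective and locally surjective, which is bijectivity
on stalks. -/
lemma stalkFunctor_map_toSheafify_bijective (P : X.Presheaf (ModuleCat.{0} k)) (x : X) :
    Function.Bijective ((TopCat.Presheaf.stalkFunctor _ x).map
      (toSheafify (Opens.grothendieckTopology X) P)) := by
  constructor
  · intro a b hab
    obtain ⟨U, hxU, p, rfl⟩ := TopCat.Presheaf.exists_germ_eq _ a
    obtain ⟨V, hxV, q, rfl⟩ := TopCat.Presheaf.exists_germ_eq _ b
    rw [TopCat.Presheaf.stalkFunctor_map_germ_apply,
      TopCat.Presheaf.stalkFunctor_map_germ_apply] at hab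
    obtain ⟨W, hxW, i, j, h⟩ := TopCat.Presheaf.germ_eq _ _ _ _ _ _ hab
    rw [← NatTrans.naturality_apply, ← NatTrans.naturality_apply] at h
    obtain ⟨Z, l, h, hxZ⟩ := Presheaf.equalizerSieve_mem (Opens.grothendieckTopology X)
      (toSheafify (Opens.grothendieckTopology X) P) _ _ h x hxW
    refine TopCat.Presheaf.germ_ext _ Z hxZ (l ≫ i) (l ≫ j) ?_
    simpa using h
  · intro a
    obtain ⟨U, hxU, s, rfl⟩ := TopCat.Presheaf.exists_germ_eq _ a
    obtain ⟨V, i, ⟨p, hp⟩, hxV⟩ := Presheaf.imageSieve_mem (Opens.grothendieckTopology X)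
      (toSheafify (Opens.grothendieckTopology X) P) s x hxU
    refine ⟨P.germ V x hxV p, ?_⟩
    rw [TopCat.Presheaf.stalkFunctor_map_germ_apply, hp]
    exact TopCat.Presheaf.germ_res_apply _ i x hxV s

variable {k} (G : Y.Sheaf (ModuleCat.{0} k))

/-- The inverse image of a sheaf of vector spaces. -/
abbrev inverseImage : X.Sheaf (ModuleCat.{0} k) := (TopCat.Sheaf.pullback (ModuleCat k) f).obj G

/-- The adjunction unit `G(W) → (f⁻¹G)(f⁻¹W)`, as a linear map. -/
def unitSec (W : Opens Y) : Sec G W →ₗ[k] Sec (inverseImage f G) ((Opens.map f).obj W) :=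
  (((TopCat.Sheaf.pullbackPushforwardAdjunction (ModuleCat k) f).unit.app G).1.app (op W)).hom

/-- The comparison map from the stalk of `G` at `f x` to the stalk at `x` of its inverse image. -/
def stalkUnit (x : X) : Stalk G (f x) →ₗ[k] Stalk (inverseImage f G) x :=
  (TopCat.Presheaf.stalkPushforward (ModuleCat k) f (inverseImage f G).presheaf x).hom ∘ₗ
  stalkMap ((TopCat.Sheaf.pullbackPushforwardAdjunction (ModuleCat k) f).unit.app G) (f x)

lemma stalkUnit_germ (x : X) (W : Opens Y) (hx : f x ∈ W) (g : Sec G W) :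
    stalkUnit f G x (germ G W (f x) hx g) =
      germ (inverseImage f G) ((Opens.map f).obj W) x hx (unitSec f G W g) := by
  refine (congrArg (TopCat.Presheaf.stalkPushforward (ModuleCat k) f
    (inverseImage f G).presheaf x).hom (stalkMap_germ
      ((TopCat.Sheaf.pullbackPushforwardAdjunction (ModuleCat k) f).unit.app G)
        W (f x) hx g)).trans ?_
  exact ConcreteCategory.congr_hom
    (TopCat.Presheaf.stalkPushforward_germ (ModuleCat k) f (inverseImage f G).presheaf W x hx) _

lemma stalkUnit_bijective (x : X) : Function.Bijective (stalkUnit f G x) := by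
  obtain ⟨θ, h⟩ := exists_iso_sheafify_pullback k f G
  let P := (TopCat.Presheaf.pullback (ModuleCat k) f).obj G.1
  let a := toSheafify (Opens.grothendieckTopology X) P
  let e := TopCat.Presheaf.stalkPullbackIso (ModuleCat k) f G.1 x
  -- The comparison map factors through the stalk of the presheaf inverse image and its
  -- sheafification; equality is checked on germs.
  have key : ⇑(stalkUnit f G x) =
      stalkMap θ.hom x ∘ (TopCat.Presheaf.stalkFunctor _ x).map a ∘ e.hom := by
    funext y
    obtain ⟨W, hx, g, rfl⟩ := exists_germ_eq _ _ y
    let u := ((TopCat.Presheaf.pullbackPushforwardAdjunction (ModuleCat k) f).unit.app G.1).app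
      (op W) g
    refine (stalkUnit_germ f G x W hx g).trans (Eq.trans ?_ (congrArg (fun z => stalkMap θ.hom x
      ((TopCat.Presheaf.stalkFunctor _ x).map a z)) (ConcreteCategory.congr_hom
        (TopCat.Presheaf.germ_stalkPullbackHom (ModuleCat k) f G.1 x W hx) g)).symm)
    refine Eq.trans ?_ (congrArg (stalkMap θ.hom x)
      (TopCat.Presheaf.stalkFunctor_map_germ_apply _ x hx a u)).symm
    refine Eq.trans ?_ (stalkMap_germ θ.hom ((Opens.map f).obj W) x hx
      (ConcreteCategory.hom (a.app _) u)).symm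
    exact congrArg (germ _ _ x hx) (ConcreteCategory.congr_hom (congr_app h (op W)) g)
  rw [key]
  exact (@stalkMap_bijective k _ X _ _ θ.hom (Iso.isIso_hom θ) x).comp
    ((stalkFunctor_map_toSheafify_bijective k P x).comp
      ((ConcreteCategory.isIso_iff_bijective e.hom).1 inferInstance))

end InverseImage

/-! ### The `γ`-topology -/

namespace GammaReal

lemma mem_of_le {W : Opens (TopCat.of GammaReal)} {x y : ℝ} (hx : ofReal x ∈ W) (h : x ≤ y) :
    ofReal y ∈ W :=
  W.isOpen.2 h hx

/-- The open ray `(c, ∞)`. -/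
def ray (c : ℝ) : Opens (TopCat.of GammaReal) :=
  ⟨{x | c < (show ℝ from x)}, isOpen_Ioi, isUpperSet_Ioi c⟩

lemma ray_le {c : ℝ} {W : Opens (TopCat.of GammaReal)} (hc : ofReal c ∈ W) : ray c ≤ W :=
  fun x hx => mem_of_le (y := x) hc (le_of_lt hx)

lemma ray_le_ray {c d : ℝ} (h : c ≤ d) : ray d ≤ ray c := fun _ hx => lt_of_le_of_lt h hx

lemma exists_ray_le {W : Opens (TopCat.of GammaReal)} {x : ℝ} (hx : ofReal x ∈ W) :
    ∃ c < x, ray c ≤ W := by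
  obtain ⟨c, hc, h⟩ := exists_Ioc_subset_of_mem_nhds (W.isOpen.1.mem_nhds hx) ⟨x - 1, sub_one_lt (show ℝ from x)⟩
  -- The endpoint `c` itself may lie outside `W`; a point strictly to its right does not.
  obtain ⟨d, hcd, hdx⟩ := exists_between hc
  exact ⟨d, hdx, ray_le (h ⟨hcd, hdx.le⟩)⟩

end GammaReal

open GammaReal

/-! ### Inverse images along the identity from the usual topology to the `γ`-topology -/

section PsiInverse

variable {k : Type} [Field k] (G : TopCat.Sheaf (ModuleCat.{0} k) (TopCat.of GammaReal))

/-- The germ of a section for the `γ`-topology. -/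
abbrev germAt (W : Opens (TopCat.of GammaReal)) (x : ℝ) (hx : ofReal x ∈ W) :
    Sec G W →ₗ[k] Stalk G (ofReal x) :=
  germ G W (ofReal x) hx

/-- Equality of germs for the `γ`-topology propagates to the right. -/
lemma germAt_eq_of_le {W W' : Opens (TopCat.of GammaReal)} {x y : ℝ} (hx : ofReal x ∈ W)
    (hx' : ofReal x ∈ W') {g : Sec G W} {g' : Sec G W'} (h : germAt G W x hx g = germAt G W' x hx' g')
    (hxy : x ≤ y) :
    germAt G W y (mem_of_le hx hxy) g = germAt G W' y (mem_of_le hx' hxy) g' := by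
  obtain ⟨U, hU, h₁, h₂, h⟩ := eventually_germ_eq G _ hx hx' g g' h
  exact germ_eq_of_res_eq G h₁ h₂ h _ (mem_of_le hU hxy)

/-- The comparison of stalks, as a map out of the stalk of `G`. -/
abbrev toStalk (x : ℝ) : Stalk G (ofReal x) →ₗ[k] Stalk (inverseImage psi G) x :=
  stalkUnit psi G x

lemma toStalk_germAt (W : Opens (TopCat.of GammaReal)) (x : ℝ) (hx : ofReal x ∈ W) (g : Sec G W) :
    toStalk G x (germAt G W x hx g) =
      germ (inverseImage psi G) ((Opens.map psi).obj W) x hx (unitSec psi G W g) :=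
  stalkUnit_germ psi G x W hx g

lemma toStalk_injective (x : ℝ) : Function.Injective (toStalk G x) :=
  (stalkUnit_bijective psi G x).1

/-- Since the stalks of $\psi^{-1}G$ and $G$ agree, a germ at `x` comes from a section of `G`, and
equality of germs holds on a usual neighbourhood of `x`. -/
lemma exists_local_lift {U : Opens (TopCat.of ℝ)} (h : Sec (inverseImage psi G) U) {x : ℝ} (hx : x ∈ U) :
    ∃ c < x, ∃ e > x, ∃ (hU : ∀ y : ℝ, c < y → y < e → y ∈ U) (g : Sec G (ray c)),
      ∀ (y : ℝ) (h₁ : c < y) (h₂ : y < e),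
        germ (inverseImage psi G) U y (hU y h₁ h₂) h = toStalk G y (germAt G (ray c) y h₁ g) := by
  obtain ⟨a, ha⟩ := (stalkUnit_bijective psi G x).2 (germ (inverseImage psi G) U x hx h)
  obtain ⟨W, hW, g, rfl⟩ := exists_germ_eq G _ a
  rw [stalkUnit_germ] at ha
  obtain ⟨N, hxN, h₁, h₂, hN⟩ := eventually_germ_eq _ _ _ _ _ _ ha
  obtain ⟨c, e, ⟨hc, he⟩, hce⟩ := mem_nhds_iff_exists_Ioo_subset.1 (N.isOpen.mem_nhds hxN)
  obtain ⟨c', hc', hW'⟩ := exists_ray_le (x := x) hW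
  have hsub : ∀ y : ℝ, max c c' < y → y < e → y ∈ N := fun y hy hy' =>
    hce ⟨(le_max_left _ _).trans_lt hy, hy'⟩
  have hle : ray (max c c') ≤ W := (ray_le_ray (le_max_right _ _)).trans hW'
  refine ⟨max c c', max_lt hc hc', e, he, fun y hy hy' => h₂ (hsub y hy hy'), res G hle g,
    fun y hy hy' => ?_⟩
  refine Eq.trans ?_ (congrArg (toStalk G y) (germ_res G hle (ofReal y) hy g).symm)
  rw [← germ_eq_of_res_eq _ h₁ h₂ hN y (hsub y hy hy')]
  exact (toStalk_germAt G W y (hle hy) g).symm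

/-- A section of `ψ⁻¹G` which agrees at `x` with a section of `G` agrees with it to the right
of `x`. -/
lemma germ_eq_toStalk_of_le {U : Opens (TopCat.of ℝ)} {W : Opens (TopCat.of GammaReal)}
    (h : Sec (inverseImage psi G) U) (g : Sec G W) {x z : ℝ} (hxz : x ≤ z)
    (hU : ∀ y : ℝ, x ≤ y → y ≤ z → y ∈ U) (hx : ofReal x ∈ W)
    (hg : germ (inverseImage psi G) U x (hU x le_rfl hxz) h = toStalk G x (germAt G W x hx g)) :
    germ (inverseImage psi G) U z (hU z hxz le_rfl) h =
      toStalk G z (germAt G W z (mem_of_le hx hxz) g) := by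
  by_contra hz
  -- Let `d` be the infimum of the points of disagreement. A local lift around `d` has the same germ
  -- as `g` at some `p ≤ d`; germs in the `γ`-topology propagate to the right, so agreement
  -- continues beyond `d`.
  let D : Set ℝ := {y | ∃ (h₁ : x ≤ y) (h₂ : y ≤ z), germ (inverseImage psi G) U y (hU y h₁ h₂) h ≠
      toStalk G y (germAt G W y (mem_of_le hx h₁) g)}
  have hzD : z ∈ D := ⟨hxz, le_rfl, hz⟩
  have hbdd : BddBelow D := ⟨x, fun y hy => hy.1⟩
  set d := sInf D
  have hxd : x ≤ d := le_csInf ⟨z, hzD⟩ fun y hy => hy.1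
  have hdz : d ≤ z := csInf_le hbdd hzD
  obtain ⟨c, hc, e, he, hU', g', hg'⟩ := exists_local_lift G h (hU d hxd hdz)
  obtain ⟨p, hxp, hpd, hcp, hp⟩ : ∃ p, ∃ (hxp : x ≤ p) (hpd : p ≤ d), c < p ∧
      germ (inverseImage psi G) U p (hU p hxp (hpd.trans hdz)) h =
        toStalk G p (germAt G W p (mem_of_le hx hxp) g) := by
    rcases hxd.eq_or_lt with hxd | hxd
    · exact ⟨x, le_rfl, hxd.le, hxd ▸ hc, hg⟩
    · obtain ⟨p, hp, hpd⟩ := exists_between (max_lt hxd hc)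
      refine ⟨p, ((le_max_left _ _).trans_lt hp).le, hpd.le, (le_max_right _ _).trans_lt hp, ?_⟩
      by_contra hne
      exact absurd (csInf_le hbdd ⟨((le_max_left _ _).trans_lt hp).le, hpd.le.trans hdz, hne⟩)
        (not_le.2 hpd)
  obtain ⟨y, hyD, hye⟩ := exists_lt_of_csInf_lt ⟨z, hzD⟩ he
  have hdy : d ≤ y := csInf_le hbdd hyD
  obtain ⟨h₁, h₂, hne⟩ := hyD
  have hpe : p < e := hpd.trans_lt he
  have hgg : germAt G W p (mem_of_le hx hxp) g = germAt G (ray c) p hcp g' :=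
    toStalk_injective G p (hp.symm.trans (hg' p hcp hpe))
  refine hne ((hg' y (hcp.trans_le (hpd.trans hdy)) hye).trans (congrArg _ ?_))
  exact (germAt_eq_of_le G _ _ hgg (hpd.trans hdy)).symm

/-- Sections of `ψ⁻¹G` over an open set which is an initial part of a `γ`-open set `W` extend
to sections of `G` over `W`. -/
lemma exists_section_of_inverseImage {U : Opens (TopCat.of ℝ)} {W : Opens (TopCat.of GammaReal)}
    (hUW : ∀ x : ℝ, x ∈ U → ofReal x ∈ W)
    (hlow : ∀ x y : ℝ, x ∈ U → y ≤ x → ofReal y ∈ W → y ∈ U)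
    (hne : ∀ x : ℝ, ofReal x ∈ W → ∃ y : ℝ, y ∈ U ∧ y ≤ x) (h : Sec (inverseImage psi G) U) :
    ∃ g : Sec G W, ∀ (x : ℝ) (hx : x ∈ U),
      germ (inverseImage psi G) U x hx h = toStalk G x (germAt G W x (hUW x hx) g) := by
  have hloc : ∀ x : U, ∃ (c : ℝ) (g : Sec G (ray c)), c < x ∧ ray c ≤ W ∧
      ∀ (z : ℝ) (hz : z ∈ U) (hcz : c < z),
        germ (inverseImage psi G) U z hz h = toStalk G z (germAt G (ray c) z hcz g) := by
    rintro ⟨x, hx⟩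
    obtain ⟨c', hc', e, he, hU', g', hg'⟩ := exists_local_lift G h hx
    obtain ⟨d, hd, hdW⟩ := exists_ray_le (hUW x hx)
    refine ⟨max c' d, res G (ray_le_ray (le_max_left _ _)) g', max_lt hc' hd,
      (ray_le_ray (le_max_right _ _)).trans hdW, fun z hz hcz => ?_⟩
    -- Taking `p` below both `x` and `z` puts it in the range of the local lift; agreement then
    -- propagates from `p` up to `z`.
    obtain ⟨p, hp, hpz⟩ := exists_between (lt_min hcz (max_lt hc' hd))
    have hcp : c' < p := (le_max_left _ _).trans_lt hp
    have hpz' : p ≤ z := hpz.le.trans (min_le_left _ _)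
    have hpW : ofReal p ∈ W := hdW ((le_max_right _ _).trans_lt hp)
    have hpe : p < e := (hpz.le.trans (min_le_right _ _)).trans_lt he
    have := germ_eq_toStalk_of_le G h g' hpz'
      (fun y hy hyz => hlow z y hz hyz (mem_of_le hpW hy)) hcp (hg' p hcp hpe)
    exact this.trans (congrArg (toStalk G z) (germ_res G (ray_le_ray (le_max_left c' d)) (ofReal z) hcz g').symm)
  choose c g hcx hcW hg using hloc
  obtain ⟨t, ht⟩ := exists_glue G W (fun x : U => ray (c x)) hcW
    (fun z hz => by
      obtain ⟨y, hyU, hyz⟩ := hne z hz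
      exact ⟨⟨y, hyU⟩, (hcx ⟨y, hyU⟩).trans_le hyz⟩) g
    -- The point `z` may lie outside `U`. The two lifts are compared at `min z (max x y)`, which is
    -- in `U`, and the equality is propagated to the right.
    (fun x y z hxz hyz => by
      have hM : ((max (x : ℝ) (y : ℝ) : ℝ)) ∈ U := by
        rcases max_choice (x : ℝ) (y : ℝ) with h | h <;> rw [h]
        exacts [x.2, y.2]
      have hcp : c x < min (show ℝ from z) (max (x : ℝ) (y : ℝ)) :=
        lt_min hxz ((hcx x).trans_le (le_max_left _ _))
      have hcp' : c y < min (show ℝ from z) (max (x : ℝ) (y : ℝ)) :=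
        lt_min hyz ((hcx y).trans_le (le_max_right _ _))
      have hpU := hlow _ _ hM (min_le_right (show ℝ from z) _) (hcW x hcp)
      exact germAt_eq_of_le G hcp hcp' (toStalk_injective G _
        ((hg x _ hpU hcp).symm.trans (hg y _ hpU hcp'))) (min_le_left _ _))
  refine ⟨t, fun x hx => (hg ⟨x, hx⟩ x hx (hcx ⟨x, hx⟩)).trans (congrArg _ ?_)⟩
  exact (ht ⟨x, hx⟩ (ofReal x) (hcx ⟨x, hx⟩)).symm

instance isIso_psi_unit : IsIso (TopCat.Sheaf.pullbackPushforwardAdjunction (ModuleCat.{0} k) psi).unit := by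
  have : ∀ G, IsIso ((TopCat.Sheaf.pullbackPushforwardAdjunction (ModuleCat.{0} k) psi).unit.app G) := by
    refine fun G => isIso_of_secMap_bijective _ fun W => ⟨fun g g' h => ?_, fun h => ?_⟩
    · refine section_ext G _ _ fun x hx => toStalk_injective G x ?_
      refine (toStalk_germAt G W x hx g).trans (Eq.trans ?_ (toStalk_germAt G W x hx g').symm)
      exact congrArg (germ (inverseImage psi G) ((Opens.map psi).obj W) x hx) h
    · obtain ⟨g, hg⟩ := exists_section_of_inverseImage G (U := (Opens.map psi).obj W) (W := W)
        (fun x hx => hx) (fun x y _ _ hy => hy) (fun x hx => ⟨x, hx, le_rfl⟩) h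
      refine ⟨g, section_ext (inverseImage psi G) _ _ fun x hx => ?_⟩
      exact (toStalk_germAt G W x hx g).symm.trans (hg x hx).symm
  exact NatIso.isIso_of_isIso_app _

end PsiInverse

/-! ### Sheaves on the Alexandrov line -/

section Alexandrov

variable (k : Type) [Field k]

/-- Passing from sheaves on the Alexandrov line to functors is left adjoint to the construction of
the sheaf of a functor. -/
def alexAdjunction : ofAlexSheaf k ⊣ toAlexSheaf k :=
  Adjunction.restrictFullyFaithful
    (((Alexandrov.principals (WithUpperSet ℝ)).ranAdjunction (ModuleCat.{0} k)).comp
      ((WithUpperSet.ofUpperSetOrderIso (α := ℝ)).equivalence.congrLeft (E := ModuleCat.{0} k)).toAdjunction)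
    (fullyFaithfulSheafToPresheaf (Opens.grothendieckTopology AlexReal) (ModuleCat.{0} k))
    (Functor.FullyFaithful.id _) (Iso.refl _) (Iso.refl _)

variable {k}

/-- The smallest open neighbourhood `[t, ∞)` of `t` in the Alexandrov line. -/
abbrev upper (t : ℝ) : Opens AlexReal := Alexandrov.principalOpen (WithUpperSet.toUpperSet t)

/-- The component at `t` of a section of the sheaf of `V`. -/
def alexComponent (V : ℝ ⥤ ModuleCat.{0} k) (U : Opens AlexReal) (t : ℝ)
    (ht : WithUpperSet.toUpperSet t ∈ U) : Sec ((toAlexSheaf k).obj V) U →ₗ[k] V.obj t :=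
  (((toAlexSheaf k).obj V).1.map (homOfLE ((Alexandrov.principalOpen_le_iff U).2 ht)).op ≫
    ((Alexandrov.principals (WithUpperSet ℝ)).ranCounit.app
      (WithUpperSet.ofUpperSetOrderIso.monotone.functor ⋙ V)).app (WithUpperSet.toUpperSet t)).hom

lemma alexComponent_res (V : ℝ ⥤ ModuleCat.{0} k) {U U' : Opens AlexReal} (h : U' ≤ U) (t : ℝ)
    (ht : WithUpperSet.toUpperSet t ∈ U') (s : Sec ((toAlexSheaf k).obj V) U) :
    alexComponent V U' t ht (res _ h s) = alexComponent V U t (h ht) s := by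
  have e := ((toAlexSheaf k).obj V).1.map_comp (homOfLE h).op
    (homOfLE ((Alexandrov.principalOpen_le_iff U').2 ht)).op
  exact congrArg (((Alexandrov.principals (WithUpperSet ℝ)).ranCounit.app
    (WithUpperSet.ofUpperSetOrderIso.monotone.functor ⋙ V)).app (WithUpperSet.toUpperSet t)).hom
    (ConcreteCategory.congr_hom e s).symm

lemma map_alexComponent (V : ℝ ⥤ ModuleCat.{0} k) (U : Opens AlexReal) {s t : ℝ} (h : s ≤ t)
    (hs : WithUpperSet.toUpperSet s ∈ U) (ht : WithUpperSet.toUpperSet t ∈ U)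
    (g : Sec ((toAlexSheaf k).obj V) U) :
    V.map (homOfLE h) (alexComponent V U s hs g) = alexComponent V U t ht g := by
  have e := ((Alexandrov.principals (WithUpperSet ℝ)).ranCounit.app
    (WithUpperSet.ofUpperSetOrderIso.monotone.functor ⋙ V)).naturality
      (homOfLE (show WithUpperSet.toUpperSet s ≤ WithUpperSet.toUpperSet t from h))
  have e' := ConcreteCategory.congr_hom e
    (((toAlexSheaf k).obj V).1.map (homOfLE ((Alexandrov.principalOpen_le_iff U).2 hs)).op g)
  refine e'.symm.trans (congrArg (((Alexandrov.principals (WithUpperSet ℝ)).ranCounit.app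
    (WithUpperSet.ofUpperSetOrderIso.monotone.functor ⋙ V)).app (WithUpperSet.toUpperSet t)).hom ?_)
  exact ConcreteCategory.congr_hom (((toAlexSheaf k).obj V).1.map_comp
    (homOfLE ((Alexandrov.principalOpen_le_iff U).2 hs)).op _).symm g

lemma alexComponent_map {V V' : ℝ ⥤ ModuleCat.{0} k} (a : V ⟶ V') (U : Opens AlexReal) (t : ℝ)
    (ht : WithUpperSet.toUpperSet t ∈ U) (g : Sec ((toAlexSheaf k).obj V) U) :
    alexComponent V' U t ht (secMap ((toAlexSheaf k).map a) U g) =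
      a.app t (alexComponent V U t ht g) := by
  have e := congr_app ((Alexandrov.principals (WithUpperSet ℝ)).ranCounit.naturality
    (Functor.whiskerLeft WithUpperSet.ofUpperSetOrderIso.monotone.functor a))
      (WithUpperSet.toUpperSet t)
  refine Eq.trans ?_ (ConcreteCategory.congr_hom e (((toAlexSheaf k).obj V).1.map
    (homOfLE ((Alexandrov.principalOpen_le_iff U).2 ht)).op g))
  exact congrArg (((Alexandrov.principals (WithUpperSet ℝ)).ranCounit.app
    (WithUpperSet.ofUpperSetOrderIso.monotone.functor ⋙ V')).app (WithUpperSet.toUpperSet t)).hom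
    (secMap_res ((toAlexSheaf k).map a) ((Alexandrov.principalOpen_le_iff U).2 ht) g).symm

/-- The universal property of the sections of the sheaf of `V`. -/
def alexIsLimit (V : ℝ ⥤ ModuleCat.{0} k) (U : Opens AlexReal) :
    IsLimit ((Functor.RightExtension.mk _ ((Alexandrov.principals (WithUpperSet ℝ)).ranCounit.app
      (WithUpperSet.ofUpperSetOrderIso.monotone.functor ⋙ V))).coneAt (op U)) :=
  (Alexandrov.principals (WithUpperSet ℝ)).isPointwiseRightKanExtensionRanCounit
    (WithUpperSet.ofUpperSetOrderIso.monotone.functor ⋙ V) (op U)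

lemma alexComponent_ext (V : ℝ ⥤ ModuleCat.{0} k) (U : Opens AlexReal)
    (g g' : Sec ((toAlexSheaf k).obj V) U)
    (h : ∀ t ht, alexComponent V U t ht g = alexComponent V U t ht g') : g = g' :=
  Concrete.isLimit_ext _ (alexIsLimit V U) g g' fun f =>
    h (WithUpperSet.ofUpperSet f.right) ((Alexandrov.principalOpen_le_iff U).1 f.hom.unop.le)

lemma exists_alexComponent_eq (V : ℝ ⥤ ModuleCat.{0} k) (U : Opens AlexReal)
    (v : ∀ t, WithUpperSet.toUpperSet t ∈ U → V.obj t)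
    (hv : ∀ (s t : ℝ) (h : s ≤ t) hs ht, V.map (homOfLE h) (v s hs) = v t ht) :
    ∃ g : Sec ((toAlexSheaf k).obj V) U, ∀ t ht, alexComponent V U t ht g = v t ht := by
  -- A compatible family is a cone with apex `k` sending `1` to its members; the lift of this cone
  -- at `1` is the section.
  let c : Cone (StructuredArrow.proj (op U) (Alexandrov.principals (WithUpperSet ℝ)) ⋙
      WithUpperSet.ofUpperSetOrderIso.monotone.functor ⋙ V) :=
    { pt := ModuleCat.of k k
      π :=
        { app := fun f => ModuleCat.ofHom (LinearMap.toSpanSingleton k _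
            (v (WithUpperSet.ofUpperSet f.right)
              ((Alexandrov.principalOpen_le_iff U).1 f.hom.unop.le)))
          naturality := fun f f' a => by
            ext
            have := hv _ _ (show WithUpperSet.ofUpperSet f.right ≤ WithUpperSet.ofUpperSet f'.right
              from a.right.le) ((Alexandrov.principalOpen_le_iff U).1 f.hom.unop.le)
                ((Alexandrov.principalOpen_le_iff U).1 f'.hom.unop.le)
            refine (one_smul k _).trans (this.symm.trans ?_)
            exact congrArg (V.map _).hom (one_smul k _).symm } }
  refine ⟨(alexIsLimit V U).lift c (1 : k), fun t ht => ?_⟩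
  have := ConcreteCategory.congr_hom ((alexIsLimit V U).fac c (StructuredArrow.mk
    (Y := WithUpperSet.toUpperSet t) (homOfLE ((Alexandrov.principalOpen_le_iff U).2 ht)).op)) (1 : k)
  exact this.trans (one_smul k _)

lemma alexAdjunction_counit (V : ℝ ⥤ ModuleCat.{0} k) (t : ℝ) (g : Sec ((toAlexSheaf k).obj V) (upper t)) :
    ((alexAdjunction k).counit.app V).app t g =
      alexComponent V (upper t) t (Alexandrov.self_mem_principalOpen _) g := by
  have h := Adjunction.map_restrictFullyFaithful_counit_app
    (((Alexandrov.principals (WithUpperSet ℝ)).ranAdjunction (ModuleCat.{0} k)).comp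
      ((WithUpperSet.ofUpperSetOrderIso (α := ℝ)).equivalence.congrLeft (E := ModuleCat.{0} k)).toAdjunction)
    (fullyFaithfulSheafToPresheaf (Opens.grothendieckTopology AlexReal) (ModuleCat.{0} k))
    (Functor.FullyFaithful.id _) (L := ofAlexSheaf k) (R := toAlexSheaf k) (Iso.refl _) (Iso.refl _) V
  have h2 := congr_app h t
  refine (ConcreteCategory.congr_hom h2 g).trans ?_
  rw [Adjunction.comp_counit_app]
  refine Eq.trans ?_ (congrArg ((((Alexandrov.principals (WithUpperSet ℝ)).ranCounit.app
    (WithUpperSet.ofUpperSetOrderIso.monotone.functor ⋙ V)).app (WithUpperSet.toUpperSet t)).hom)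
     (ConcreteCategory.congr_hom (((toAlexSheaf k).obj V).1.map_id (op (upper t))) g).symm)
  refine (ConcreteCategory.congr_hom (V.map_id t) _)

/-- A triangle identity, applied after restricting to the smallest neighbourhood of `t`, where the
component map is the counit. -/
lemma alexComponent_unit (F : TopCat.Sheaf (ModuleCat.{0} k) AlexReal) (U : Opens AlexReal) (t : ℝ)
    (ht : WithUpperSet.toUpperSet t ∈ U) (s : Sec F U) :
    alexComponent ((ofAlexSheaf k).obj F) U t ht (secMap ((alexAdjunction k).unit.app F) U s) =
      res F ((Alexandrov.principalOpen_le_iff U).2 ht) s := by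
  have e := ConcreteCategory.congr_hom (congr_app ((alexAdjunction k).left_triangle_components F) t)
    (res F ((Alexandrov.principalOpen_le_iff U).2 ht) s)
  refine Eq.trans ?_ e
  refine Eq.trans ?_ (alexAdjunction_counit ((ofAlexSheaf k).obj F) t _).symm
  refine (alexComponent_res _ ((Alexandrov.principalOpen_le_iff U).2 ht) t
    (Alexandrov.self_mem_principalOpen _) _).symm.trans ?_
  exact congrArg (alexComponent _ _ t _) (secMap_res ((alexAdjunction k).unit.app F) _ s).symm

end Alexandrov

/-! ### Sheaves for the `γ`-topology and functors on the real line -/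

section GammaSheaves

variable (k : Type) [Field k]

/-- The functor `t ↦ (φ⁻¹G)([t, ∞))` attached to a sheaf `G` for the `γ`-topology. -/
abbrev ofGammaSheaf : TopCat.Sheaf (ModuleCat.{0} k) (TopCat.of GammaReal) ⥤ (ℝ ⥤ ModuleCat.{0} k) :=
  TopCat.Sheaf.pullback (ModuleCat.{0} k) phi ⋙ ofAlexSheaf k

/-- The sheaf for the `γ`-topology attached to a functor, with sections `lim_{t ∈ W} V_t`. -/
abbrev toGammaSheaf : (ℝ ⥤ ModuleCat.{0} k) ⥤ TopCat.Sheaf (ModuleCat.{0} k) (TopCat.of GammaReal) :=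
  toAlexSheaf k ⋙ TopCat.Sheaf.pushforward (ModuleCat.{0} k) phi

/-- Sheaves for the `γ`-topology and functors are related by an adjunction. -/
def gammaAdjunction : ofGammaSheaf k ⊣ toGammaSheaf k :=
  (TopCat.Sheaf.pullbackPushforwardAdjunction (ModuleCat.{0} k) phi).comp (alexAdjunction k)

variable {k}

/-- The component at `t` of a section of the sheaf of `V` for the `γ`-topology. -/
def component (V : ℝ ⥤ ModuleCat.{0} k) (W : Opens (TopCat.of GammaReal)) (t : ℝ)
    (ht : ofReal t ∈ W) : Sec ((toGammaSheaf k).obj V) W →ₗ[k] V.obj t :=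
  alexComponent V ((Opens.map phi).obj W) t ht

section Component

variable (V : ℝ ⥤ ModuleCat.{0} k)

lemma component_res {W W' : Opens (TopCat.of GammaReal)} (h : W' ≤ W) (t : ℝ)
    (ht : ofReal t ∈ W') (g : Sec ((toGammaSheaf k).obj V) W) :
    component V W' t ht (res _ h g) = component V W t (h ht) g :=
  alexComponent_res V (U := (Opens.map phi).obj W) (U' := (Opens.map phi).obj W')
    (fun _ hx => h hx) t ht g

lemma map_component (W : Opens (TopCat.of GammaReal)) {s t : ℝ} (h : s ≤ t) (hs : ofReal s ∈ W)
    (g : Sec ((toGammaSheaf k).obj V) W) :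
    V.map (homOfLE h) (component V W s hs g) = component V W t (mem_of_le hs h) g :=
  map_alexComponent V _ h hs (mem_of_le hs h) g

lemma component_map {V V' : ℝ ⥤ ModuleCat.{0} k} (a : V ⟶ V') (W : Opens (TopCat.of GammaReal))
    (t : ℝ) (ht : ofReal t ∈ W) (g : Sec ((toGammaSheaf k).obj V) W) :
    component V' W t ht (secMap ((toGammaSheaf k).map a) W g) = a.app t (component V W t ht g) :=
  alexComponent_map a _ t ht g

lemma component_ext (W : Opens (TopCat.of GammaReal)) (g g' : Sec ((toGammaSheaf k).obj V) W)
    (h : ∀ t ht, component V W t ht g = component V W t ht g') : g = g' :=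
  alexComponent_ext V _ g g' h

lemma exists_component_eq (W : Opens (TopCat.of GammaReal)) (v : ∀ t, ofReal t ∈ W → V.obj t)
    (hv : ∀ (s t : ℝ) (h : s ≤ t) hs ht, V.map (homOfLE h) (v s hs) = v t ht) :
    ∃ g : Sec ((toGammaSheaf k).obj V) W, ∀ t ht, component V W t ht g = v t ht :=
  exists_alexComponent_eq V ((Opens.map phi).obj W) v hv

end Component

/-! ### Stalks of `γ`-sheaves as values of functors. -/

section Values

variable (G : TopCat.Sheaf (ModuleCat.{0} k) (TopCat.of GammaReal))

/-- The colimit defining the stalk is attained at the smallest neighbourhood of `t`. -/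
lemma germ_upper_bijective (F : TopCat.Sheaf (ModuleCat.{0} k) AlexReal) (t : ℝ) :
    Function.Bijective (germ F (upper t) (WithUpperSet.toUpperSet t)
      (Alexandrov.self_mem_principalOpen _)) := by
  constructor
  · intro s s' h
    obtain ⟨W, hW, h₁, h₂, h⟩ := eventually_germ_eq F _ _ _ s s' h
    refine section_ext F _ _ fun x hx => ?_
    exact germ_eq_of_res_eq F h₁ h₂ h x ((Alexandrov.principalOpen_le_iff W).2 hW hx)
  · intro a
    obtain ⟨W, hW, s, rfl⟩ := exists_germ_eq F _ a
    exact ⟨res F ((Alexandrov.principalOpen_le_iff W).2 hW) s, germ_res F _ _ _ s⟩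

/-- The value at `t` of the functor attached to `G` is the stalk of `G` at `t`. -/
def valueEquiv (t : ℝ) : Stalk G (ofReal t) ≃ₗ[k] ((ofGammaSheaf k).obj G).obj t :=
  (LinearEquiv.ofBijective (stalkUnit phi G (WithUpperSet.toUpperSet t))
    (stalkUnit_bijective phi G _)).trans
    (LinearEquiv.ofBijective _ (germ_upper_bijective (inverseImage phi G) t)).symm

lemma valueEquiv_germAt (W : Opens (TopCat.of GammaReal)) (t : ℝ) (ht : ofReal t ∈ W)
    (g : Sec G W) :
    valueEquiv G t (germAt G W t ht g) =
      res (inverseImage phi G) (U := (Opens.map phi).obj W) (V := upper t)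
        ((Alexandrov.principalOpen_le_iff _).2 ht) (unitSec phi G W g) := by
  refine (LinearEquiv.symm_apply_eq _).2 ?_
  refine (stalkUnit_germ phi G (WithUpperSet.toUpperSet t) W ht g).trans ?_
  exact (germ_res (inverseImage phi G) (U := (Opens.map phi).obj W) (V := upper t)
    ((Alexandrov.principalOpen_le_iff _).2 ht) _ _ _).symm

lemma map_valueEquiv_germAt (W : Opens (TopCat.of GammaReal)) {s t : ℝ} (h : s ≤ t)
    (hs : ofReal s ∈ W) (g : Sec G W) :
    ((ofGammaSheaf k).obj G).map (homOfLE h) (valueEquiv G s (germAt G W s hs g)) =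
      valueEquiv G t (germAt G W t (mem_of_le hs h) g) := by
  rw [valueEquiv_germAt, valueEquiv_germAt]
  exact (ConcreteCategory.congr_hom ((inverseImage phi G).1.map_comp
    (homOfLE ((Alexandrov.principalOpen_le_iff ((Opens.map phi).obj W)).2 hs)).op
    (homOfLE (Alexandrov.principalOpen_le (show WithUpperSet.toUpperSet s ≤
      WithUpperSet.toUpperSet t from h))).op) (unitSec phi G W g)).symm

lemma component_unit (W : Opens (TopCat.of GammaReal)) (t : ℝ) (ht : ofReal t ∈ W) (g : Sec G W) :
    component ((ofGammaSheaf k).obj G) W t ht (secMap ((gammaAdjunction k).unit.app G) W g) =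
      valueEquiv G t (germAt G W t ht g) := by
  rw [valueEquiv_germAt, gammaAdjunction, Adjunction.comp_unit_app]
  exact alexComponent_unit (inverseImage phi G) ((Opens.map phi).obj W) t ht (unitSec phi G W g)

/-- By the other triangle identity and `component_unit`; it turns invertibility of the counit into a
question about compatible families. -/
lemma counit_valueEquiv_germAt (V : ℝ ⥤ ModuleCat.{0} k) (W : Opens (TopCat.of GammaReal)) (t : ℝ)
    (ht : ofReal t ∈ W) (g : Sec ((toGammaSheaf k).obj V) W) :
    ((gammaAdjunction k).counit.app V).app t (valueEquiv _ t (germAt _ W t ht g)) =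
      component V W t ht g := by
  rw [← component_unit]
  refine (component_map ((gammaAdjunction k).counit.app V) W t ht _).symm.trans ?_
  refine congrArg (component V W t ht) ?_
  exact ConcreteCategory.congr_hom (congr_app (congrArg (fun a => a.1)
    ((gammaAdjunction k).right_triangle_components V)) (op W)) g

instance isIso_gammaAdjunction_unit : IsIso (gammaAdjunction k).unit := by
  have : ∀ G, IsIso ((gammaAdjunction k).unit.app G) := by
    refine fun G => isIso_of_secMap_bijective _ fun W => ⟨fun g g' h => ?_, fun h => ?_⟩
    · refine section_ext G _ _ fun x hx => (valueEquiv G x).injective ?_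
      refine (component_unit G W x hx g).symm.trans (Eq.trans ?_ (component_unit G W x hx g'))
      exact congrArg (component _ W x hx) h
    -- To the right of a point `c < x`, a compatible family is determined by its value at `c`. That
    -- value is a germ of `G` at `c`, represented by a section whose domain contains the whole ray.
    · have hloc : ∀ x : {x : ℝ // ofReal x ∈ W}, ∃ (c : ℝ) (g : Sec G (ray c)), c < x ∧ ray c ≤ W ∧
          ∀ (t : ℝ) (hc : c < t) (ht : ofReal t ∈ W), component _ W t ht h =
            valueEquiv G t (germAt G (ray c) t hc g) := by
        rintro ⟨x, hx⟩
        obtain ⟨d, hdx, hdW⟩ := exists_ray_le hx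
        obtain ⟨c, hdc, hcx⟩ := exists_between hdx
        obtain ⟨a, ha⟩ := (valueEquiv G c).surjective (component _ W c (hdW hdc) h)
        obtain ⟨U, hU, g, rfl⟩ := exists_germ_eq G _ a
        refine ⟨c, res G (ray_le hU) g, hcx, ray_le (hdW hdc), fun t hct ht => ?_⟩
        refine (map_component _ W (le_of_lt hct) (hdW hdc) h).symm.trans ?_
        rw [← ha]
        refine (map_valueEquiv_germAt G U (le_of_lt hct) hU g).trans (congrArg _ ?_)
        exact (germ_res G (ray_le hU) (ofReal t) hct g).symm
      choose c g hcx hcW hg using hloc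
      obtain ⟨t, ht⟩ := exists_glue G W (fun x : {x : ℝ // ofReal x ∈ W} => ray (c x)) hcW
        (fun z hz => ⟨⟨z, hz⟩, hcx ⟨z, hz⟩⟩) g
        (fun x y z hxz hyz => (valueEquiv G z).injective
          ((hg x z hxz (hcW x hxz)).symm.trans (hg y z hyz (hcW x hxz))))
      refine ⟨t, component_ext _ W _ _ fun x hx => ?_⟩
      refine (component_unit G W x hx t).trans ((congrArg _ ?_).trans
        (hg ⟨x, hx⟩ x (hcx ⟨x, hx⟩) hx).symm)
      exact ht ⟨x, hx⟩ (ofReal x) (hcx ⟨x, hx⟩)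
  exact NatIso.isIso_of_isIso_app _

end Values

end GammaSheaves

/-! ### When the counits are isomorphisms -/

section Counits

variable {k : Type} [Field k]

lemma germ_eq_zero_of_germ_eq_zero (G : TopCat.Sheaf (ModuleCat.{0} k) (TopCat.of GammaReal))
    (W : Opens (TopCat.of GammaReal)) {x : ℝ} (hx : ofReal x ∈ W) {g : Sec G W}
    (h : germAt G W x hx g = 0) :
    ∃ c < x, ∀ (s : ℝ) (hs : ofReal s ∈ W), c < s → germAt G W s hs g = 0 := by
  obtain ⟨U, hU, h₁, h₂, h⟩ := eventually_germ_eq G _ hx hx g 0 (by rw [map_zero]; exact h)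
  obtain ⟨c, hc, hcU⟩ := exists_ray_le (x := x) hU
  refine ⟨c, hc, fun s hs hcs => ?_⟩
  exact (germ_eq_of_res_eq G h₁ h₂ h (ofReal s) (hcU hcs)).trans (map_zero _)

/-- The counit of the adjunction between sheaves for the `γ`-topology and functors is an isomorphism
at `V` if and only if the elements of `V_t` are the germs to the left of `t` of compatible
families. -/
lemma isIso_gammaAdjunction_counit_iff (V : ℝ ⥤ ModuleCat.{0} k) :
    IsIso ((gammaAdjunction k).counit.app V) ↔
      (∀ (t : ℝ) (v : V.obj t), ∃ (W : Opens (TopCat.of GammaReal)) (ht : ofReal t ∈ W)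
        (g : Sec ((toGammaSheaf k).obj V) W), component V W t ht g = v) ∧
      ∀ (W : Opens (TopCat.of GammaReal)) (t : ℝ) (ht : ofReal t ∈ W)
        (g : Sec ((toGammaSheaf k).obj V) W), component V W t ht g = 0 →
          ∃ c < t, ∀ (s : ℝ) (hs : ofReal s ∈ W), c < s → component V W s hs g = 0 := by
  -- Precomposed with `valueEquiv`, the counit sends a germ to its component, so the two conditions
  -- express surjectivity and injectivity.
  have hval : ∀ t, Function.Bijective (((gammaAdjunction k).counit.app V).app t) ↔
      Function.Bijective (fun a => ((gammaAdjunction k).counit.app V).app t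
        (valueEquiv ((toGammaSheaf k).obj V) t a)) := fun t =>
    (Function.Bijective.of_comp_iff _ (valueEquiv ((toGammaSheaf k).obj V) t).bijective).symm
  constructor
  · intro h
    have hb := fun t => (hval t).1 ((ConcreteCategory.isIso_iff_bijective _).1 inferInstance)
    constructor
    · intro t v
      obtain ⟨a, ha⟩ := (hb t).2 v
      obtain ⟨W, hW, g, rfl⟩ := exists_germ_eq _ _ a
      exact ⟨W, hW, g, (counit_valueEquiv_germAt V W t hW g).symm.trans ha⟩
    · intro W t ht g hg
      have hzero : germAt _ W t ht g = 0 := (hb t).1 (by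
        refine (counit_valueEquiv_germAt V W t ht g).trans (hg.trans ?_)
        simp only [map_zero])
      obtain ⟨c, hc, h⟩ := germ_eq_zero_of_germ_eq_zero _ W ht hzero
      refine ⟨c, hc, fun s hs hcs => ?_⟩
      rw [← counit_valueEquiv_germAt, h s hs hcs]
      simp only [map_zero]
  · rintro ⟨h₁, h₂⟩
    have : ∀ t, IsIso (((gammaAdjunction k).counit.app V).app t) := by
      refine fun t => (ConcreteCategory.isIso_iff_bijective _).2 ((hval t).2 ⟨?_, fun v => ?_⟩)
      · refine (injective_iff_map_eq_zero ((((gammaAdjunction k).counit.app V).app t).hom ∘ₗ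
          (valueEquiv ((toGammaSheaf k).obj V) t).toLinearMap)).2 fun a ha => ?_
        obtain ⟨W, hW, g, rfl⟩ := exists_germ_eq _ _ a
        obtain ⟨c, hc, h⟩ := h₂ W t hW g ((counit_valueEquiv_germAt V W t hW g).symm.trans ha)
        have hz : res ((toGammaSheaf k).obj V) (inf_le_left : W ⊓ ray c ≤ W) g = 0 := by
          refine component_ext V _ _ _ fun s hs => ?_
          rw [component_res, h s hs.1 hs.2, map_zero]
        refine (germ_res _ (inf_le_left : W ⊓ ray c ≤ W) (ofReal t) ⟨hW, hc⟩ g).symm.trans ?_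
        rw [hz, map_zero]
      · obtain ⟨W, ht, g, rfl⟩ := h₁ t v
        exact ⟨germAt _ W t ht g, counit_valueEquiv_germAt V W t ht g⟩
    exact NatIso.isIso_of_isIso_app _

/-! ### The counit for `psi`. -/

section Psi

variable (F : TopCat.Sheaf (ModuleCat.{0} k) (TopCat.of ℝ))

/-- The direct image of `F` for the `γ`-topology. -/
abbrev directImage : TopCat.Sheaf (ModuleCat.{0} k) (TopCat.of GammaReal) :=
  (TopCat.Sheaf.pushforward (ModuleCat.{0} k) psi).obj F

/-- The germ at `x` of a section of the direct image of `F`. -/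
def germDirect (W : Opens (TopCat.of GammaReal)) (x : ℝ) (hx : ofReal x ∈ W) :
    Sec (directImage F) W →ₗ[k] Stalk F x :=
  germ F ((Opens.map psi).obj W) x hx

/-- The counit `ψ⁻¹ψ_*F → F`. -/
def psiCounit : inverseImage psi (directImage F) ⟶ F :=
  (TopCat.Sheaf.pullbackPushforwardAdjunction (ModuleCat.{0} k) psi).counit.app F

lemma counit_toStalk_germAt (W : Opens (TopCat.of GammaReal)) (x : ℝ) (hx : ofReal x ∈ W)
    (g : Sec (directImage F) W) :
    stalkMap (psiCounit F) x
      (toStalk (directImage F) x (germAt (directImage F) W x hx g)) = germDirect F W x hx g := by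
  rw [toStalk_germAt]
  refine (stalkMap_germ (psiCounit F) ((Opens.map psi).obj W) x hx (unitSec psi (directImage F) W g)).trans ?_
  refine congrArg (germ F ((Opens.map psi).obj W) x hx) ?_
  exact ConcreteCategory.congr_hom (congr_app (congrArg (fun a => a.1)
    ((TopCat.Sheaf.pullbackPushforwardAdjunction (ModuleCat.{0} k)
      psi).right_triangle_components F)) (op W)) g

/-- The counit `ψ⁻¹ψ_*F → F` is an isomorphism if and only if the germs of `F` at every point are
the germs of sections over `γ`-open sets, and determine these sections near the point for the
`γ`-topology. -/
lemma isIso_psi_counit_iff :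
    IsIso (psiCounit F) ↔
      (∀ (x : ℝ) (a : Stalk F x), ∃ (W : Opens (TopCat.of GammaReal)) (hx : ofReal x ∈ W)
        (g : Sec (directImage F) W), germDirect F W x hx g = a) ∧
      ∀ (W : Opens (TopCat.of GammaReal)) (x : ℝ) (hx : ofReal x ∈ W)
        (g : Sec (directImage F) W), germDirect F W x hx g = 0 →
          ∃ c < x, ∀ (s : ℝ) (hs : ofReal s ∈ W), c < s → germDirect F W s hs g = 0 := by
  have hval : ∀ x : ℝ, Function.Bijective (stalkMap (psiCounit F) x) ↔
      Function.Bijective (fun a => stalkMap (psiCounit F) x (toStalk (directImage F) x a)) := fun x =>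
    (Function.Bijective.of_comp_iff _ (stalkUnit_bijective psi (directImage F) x)).symm
  constructor
  · intro h
    have hb := fun x : ℝ => (hval x).1 (stalkMap_bijective (psiCounit F) x)
    constructor
    · intro x v
      obtain ⟨a, ha⟩ := (hb x).2 v
      obtain ⟨W, hW, g, rfl⟩ := exists_germ_eq (directImage F) (ofReal x) a
      exact ⟨W, hW, g, (counit_toStalk_germAt F W x hW g).symm.trans ha⟩
    · intro W t ht g hg
      have hzero : germAt (directImage F) W t ht g = 0 := (hb t).1 (by
        exact (counit_toStalk_germAt F W t ht g).trans (hg.trans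
          (by simp only [map_zero])))
      obtain ⟨c, hc, h⟩ := germ_eq_zero_of_germ_eq_zero (directImage F) W ht hzero
      refine ⟨c, hc, fun s hs hcs => ?_⟩
      rw [← counit_toStalk_germAt, h s hs hcs]
      simp only [map_zero]
  · rintro ⟨h₁, h₂⟩
    refine isIso_of_stalkMap_bijective (psiCounit F) fun x => (hval x).2 ⟨?_, fun v => ?_⟩
    · refine (injective_iff_map_eq_zero (stalkMap (psiCounit F) x ∘ₗ toStalk (directImage F) x)).2 fun a ha => ?_
      obtain ⟨W, hW, g, rfl⟩ := exists_germ_eq (directImage F) (ofReal x) a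
      obtain ⟨c, hc, h⟩ := h₂ W x hW g ((counit_toStalk_germAt F W x hW g).symm.trans ha)
      have hz : res (directImage F) (inf_le_left : W ⊓ ray c ≤ W) g = 0 := by
        refine section_ext F (U := (Opens.map psi).obj (W ⊓ ray c)) _ _ fun s hs => ?_
        refine (germ_res F (U := (Opens.map psi).obj W) (V := (Opens.map psi).obj (W ⊓ ray c))
          (fun _ h => h.1) s hs g).trans ((h s hs.1 hs.2).trans (map_zero _).symm)
      refine (germ_res _ (inf_le_left : W ⊓ ray c ≤ W) (ofReal x) ⟨hW, hc⟩ g).symm.trans ?_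
      rw [hz, map_zero]
    · obtain ⟨W, ht, g, rfl⟩ := h₁ x v
      exact ⟨germAt (directImage F) W x ht g, counit_toStalk_germAt F W x ht g⟩

end Psi

end Counits

/-! ### Bars -/

section BarLemmas

/-- A bar without minimum, which contains its supremum unless it is unbounded above. -/
def Bar.IsLeftContinuous (I : Bar) : Prop :=
  (∀ t ∈ (I : Set ℝ), ∃ s < t, s ∈ (I : Set ℝ)) ∧
    ∀ t ∉ (I : Set ℝ), (∃ y ∈ (I : Set ℝ), y < t) → ∃ c < t, ∀ s > c, s ∉ (I : Set ℝ)

/-- The condition without endpoints is the one the counit criteria produce. Conversely, the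
endpoints are the infimum and supremum in `EReal`, which also covers infinite ones. -/
lemma Bar.isLeftOpenRightClosed_iff (I : Bar) :
    I.IsLeftOpenRightClosed ↔ I.IsLeftContinuous := by
  constructor
  · rintro ⟨a, b, h⟩
    refine ⟨fun t ht => ?_, fun t ht ⟨y, hy, hyt⟩ => ?_⟩
    · rw [h] at ht ⊢
      obtain ⟨s, h₁, h₂⟩ := EReal.lt_iff_exists_real_btwn.1 ht.1
      exact ⟨s, EReal.coe_lt_coe_iff.1 h₂, h₁, h₂.le.trans ht.2⟩
    · rw [h] at ht hy ⊢
      have hbt : b < t := not_le.1 fun hb => ht ⟨hy.1.trans (EReal.coe_lt_coe_iff.2 hyt), hb⟩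
      obtain ⟨c, h₁, h₂⟩ := EReal.lt_iff_exists_real_btwn.1 hbt
      exact ⟨c, EReal.coe_lt_coe_iff.1 h₂, fun s hs hsI =>
        absurd hsI.2 (not_le.2 (h₁.trans (EReal.coe_lt_coe_iff.2 hs)))⟩
  · rintro ⟨h₁, h₂⟩
    refine ⟨sInf ((↑) '' (I : Set ℝ)), sSup ((↑) '' (I : Set ℝ)), Set.ext fun t => ⟨fun ht => ?_, ?_⟩⟩
    · obtain ⟨s, hst, hs⟩ := h₁ t ht
      exact ⟨(sInf_le (Set.mem_image_of_mem _ hs)).trans_lt (EReal.coe_lt_coe_iff.2 hst),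
        le_sSup (Set.mem_image_of_mem _ ht)⟩
    · rintro ⟨hat, htb⟩
      by_contra ht
      obtain ⟨_, ⟨s, hs, rfl⟩, hst⟩ := sInf_lt_iff.1 hat
      obtain ⟨c, hc, h⟩ := h₂ t ht ⟨s, hs, EReal.coe_lt_coe_iff.1 hst⟩
      refine absurd htb (not_le.2 (lt_of_le_of_lt (sSup_le ?_) (EReal.coe_lt_coe_iff.2 hc)))
      rintro _ ⟨y, hy, rfl⟩
      exact EReal.coe_le_coe_iff.2 (not_lt.1 fun hcy => h y hcy hy)

end BarLemmas

/-! ### Compatible families -/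

section CompatibleFamilies

variable {k : Type} [Field k]

/-- Compatible families for the interval module of `I` over a `γ`-open set. -/
structure IsCompatibleFamily (I : Bar) (W : Opens (TopCat.of GammaReal)) (v : ℝ → k) : Prop where
  eq_zero : ∀ t, t ∉ (I : Set ℝ) → v t = 0
  eq_of_le : ∀ s t, s ≤ t → ofReal s ∈ W → t ∈ (I : Set ℝ) → v s = v t

open Classical in
lemma isCompatibleFamily_indicator (I : Bar) {c : ℝ} (hc : c ∈ (I : Set ℝ)) (x : k) :
    IsCompatibleFamily I (ray c) (fun t => if t ∈ (I : Set ℝ) then x else 0) where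
  eq_zero t ht := if_neg ht
  eq_of_le s t hst hs ht := by
    have : s ∈ (I : Set ℝ) := I.2.2.out hc ht ⟨le_of_lt hs, hst⟩
    rw [if_pos this, if_pos ht]

lemma isCompatibleFamily_zero (I : Bar) (W : Opens (TopCat.of GammaReal)) :
    IsCompatibleFamily I W (fun _ => (0 : k)) :=
  ⟨fun _ _ => rfl, fun _ _ _ _ _ => rfl⟩

-- Supplies surjectivity of both counits: since the bar has no minimum, an indicator family can
-- start inside the bar to the left of `t`.
open Classical in
lemma Bar.IsLeftContinuous.exists_compatible {I : Bar} (hI : I.IsLeftContinuous) (t : ℝ) (x : k)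
    (hx : t ∉ (I : Set ℝ) → x = 0) :
    ∃ (W : Opens (TopCat.of GammaReal)) (v : ℝ → k), ofReal t ∈ W ∧ IsCompatibleFamily I W v ∧
      v t = x := by
  by_cases ht : t ∈ (I : Set ℝ)
  · obtain ⟨c, hct, hc⟩ := hI.1 t ht
    exact ⟨ray c, _, hct, isCompatibleFamily_indicator I hc x, if_pos ht⟩
  · exact ⟨⊤, _, trivial, isCompatibleFamily_zero I _, (hx ht).symm⟩

/-- Supplies injectivity of both counits. The cases are `t` in the bar, `t` to its right (the bar
stays away from `t`), and `t` to its left (all values on the bar are transported from `v t = 0`). -/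
lemma Bar.IsLeftContinuous.eventually_eq_zero {I : Bar} (hI : I.IsLeftContinuous)
    {W : Opens (TopCat.of GammaReal)} {v : ℝ → k} (hv : IsCompatibleFamily I W v) {t : ℝ}
    (ht : ofReal t ∈ W) (h : v t = 0) :
    ∃ c < t, ∀ s, ofReal s ∈ W → c < s → v s = 0 := by
  by_cases htI : t ∈ (I : Set ℝ)
  · obtain ⟨c, hct, hc⟩ := hI.1 t htI
    refine ⟨c, hct, fun s hs hcs => ?_⟩
    by_cases hsI : s ∈ (I : Set ℝ)
    · rcases le_total s t with hst | hst
      · exact (hv.eq_of_le s t hst hs htI).trans h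
      · exact (hv.eq_of_le t s hst ht hsI).symm.trans h
    · exact hv.eq_zero s hsI
  · by_cases hy : ∃ y ∈ (I : Set ℝ), y < t
    · obtain ⟨c, hct, hc⟩ := hI.2 t htI hy
      exact ⟨c, hct, fun s _ hcs => hv.eq_zero s (hc s hcs)⟩
    · refine ⟨t - 1, sub_one_lt t, fun s hs _ => ?_⟩
      by_cases hsI : s ∈ (I : Set ℝ)
      · exact (hv.eq_of_le t s (not_lt.1 fun hst => hy ⟨s, hsI, hst⟩) ht hsI).symm.trans h
      · exact hv.eq_zero s hsI

end CompatibleFamilies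

/-! ### Interval modules -/

section IntervalModules

variable (k : Type) [Field k]

lemma intervalModule_map_val (I : Bar) {s t : ℝ} (h : s ⟶ t) (ht : t ∈ (I : Set ℝ))
    (x : intervalValue k I s) : ((intervalModule k I).map h x : intervalValue k I t).1 = x.1 :=
  if_pos ht

open Classical in
/-- The family of values of a section of the sheaf of an interval module. -/
def sectionValue (I : Bar) (W : Opens (TopCat.of GammaReal))
    (g : Sec ((toGammaSheaf k).obj (intervalModule k I)) W) (t : ℝ) : k :=
  if ht : ofReal t ∈ W then (component (intervalModule k I) W t ht g : intervalValue k I t).1 else 0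

lemma sectionValue_of_mem (I : Bar) (W : Opens (TopCat.of GammaReal))
    (g : Sec ((toGammaSheaf k).obj (intervalModule k I)) W) {t : ℝ} (ht : ofReal t ∈ W) :
    sectionValue k I W g t = (component (intervalModule k I) W t ht g : intervalValue k I t).1 :=
  dif_pos ht

lemma isCompatibleFamily_sectionValue (I : Bar) (W : Opens (TopCat.of GammaReal))
    (g : Sec ((toGammaSheaf k).obj (intervalModule k I)) W) :
    IsCompatibleFamily I W (sectionValue k I W g) where
  eq_zero t ht := by
    by_cases hW : ofReal t ∈ W
    · rw [sectionValue_of_mem k I W g hW]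
      exact (component (intervalModule k I) W t hW g : intervalValue k I t).2 ht
    · exact dif_neg hW
  eq_of_le s t hst hs ht := by
    rw [sectionValue_of_mem k I W g hs, sectionValue_of_mem k I W g (mem_of_le hs hst),
      ← map_component _ W hst hs g]
    exact (intervalModule_map_val k I _ ht _).symm

lemma exists_section_of_isCompatibleFamily (I : Bar) (W : Opens (TopCat.of GammaReal)) {v : ℝ → k}
    (hv : IsCompatibleFamily I W v) :
    ∃ g : Sec ((toGammaSheaf k).obj (intervalModule k I)) W, ∀ t (ht : ofReal t ∈ W),
      (component (intervalModule k I) W t ht g : intervalValue k I t).1 = v t := by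
  obtain ⟨g, hg⟩ := exists_component_eq (intervalModule k I) W
    (fun t _ => (⟨v t, hv.eq_zero t⟩ : intervalValue k I t)) (fun s t hst hs ht => by
      refine Subtype.ext ?_
      by_cases htI : t ∈ (I : Set ℝ)
      · exact (intervalModule_map_val k I _ htI _).trans (hv.eq_of_le s t hst hs htI)
      · exact (((intervalModule k I).map (homOfLE hst) (⟨v s, hv.eq_zero s⟩ :
          intervalValue k I s) : intervalValue k I t).2 htI).trans (hv.eq_zero t htI).symm)
  exact ⟨g, fun t ht => congrArg Subtype.val (hg t ht)⟩

open Classical in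
lemma isIso_counit_intervalModule_iff (I : Bar) :
    IsIso ((gammaAdjunction k).counit.app (intervalModule k I)) ↔ I.IsLeftContinuous := by
  rw [isIso_gammaAdjunction_counit_iff]
  constructor
  · rintro ⟨h₁, h₂⟩
    refine ⟨fun t ht => ?_, fun t ht ⟨y, hy, hyt⟩ => ?_⟩
    -- A family with value `1` at `t` that starts to the left of `t` must be nonzero there, so the
    -- bar has points below `t`.
    · obtain ⟨W, htW, g, hg⟩ := h₁ t (⟨1, fun h => absurd ht h⟩ : intervalValue k I t)
      obtain ⟨c, hct, hcW⟩ := exists_ray_le htW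
      obtain ⟨s, hcs, hst⟩ := exists_between hct
      refine ⟨s, hst, by_contra fun hs => ?_⟩
      have hv := isCompatibleFamily_sectionValue k I W g
      have := (hv.eq_zero s hs).symm.trans (hv.eq_of_le s t hst.le (hcW hcs) ht)
      rw [sectionValue_of_mem k I W g htW, hg] at this
      exact zero_ne_one this
    -- The indicator starting at `y` vanishes at `t`, hence just to the left of `t`; so the bar has
    -- no points there.
    · obtain ⟨g, hg⟩ := exists_section_of_isCompatibleFamily k I _
        (isCompatibleFamily_indicator I hy (1 : k))
      obtain ⟨c, hct, hc⟩ := h₂ _ t hyt g (Subtype.ext ((hg t hyt).trans (if_neg ht)))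
      refine ⟨max c y, max_lt hct hyt, fun s hs hsI => ?_⟩
      have hys : y < s := (le_max_right _ _).trans_lt hs
      have := (hg s hys).symm.trans (congrArg Subtype.val (hc s hys ((le_max_left _ _).trans_lt hs)))
      rw [if_pos hsI] at this
      exact one_ne_zero this
  · intro hI
    refine ⟨fun t v => ?_, fun W t ht g hg => ?_⟩
    · obtain ⟨W, f, htW, hf, hft⟩ := hI.exists_compatible t (v : intervalValue k I t).1
        (v : intervalValue k I t).2
      obtain ⟨g, hg⟩ := exists_section_of_isCompatibleFamily k I W hf
      exact ⟨W, htW, g, Subtype.ext ((hg t htW).trans hft)⟩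
    · obtain ⟨c, hct, h⟩ := hI.eventually_eq_zero (isCompatibleFamily_sectionValue k I W g) ht
        ((sectionValue_of_mem k I W g ht).trans (congrArg Subtype.val hg))
      refine ⟨c, hct, fun s hs hcs => Subtype.ext ?_⟩
      exact (sectionValue_of_mem k I W g hs).symm.trans (h s hs hcs)

end IntervalModules

/-! ### Interval sheaves -/

section IntervalSheaves

variable (k : Type) [Field k]

/-- The value at `x` of a section of an interval sheaf. -/
def value (I : Bar) {U : Opens (TopCat.of ℝ)} (f : Sec (intervalSheaf k I) U) (x : ℝ) (hx : x ∈ U) :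
    k := (f : intervalSections k I U).1 ⟨x, hx⟩

variable {k}

section

variable {I : Bar} {U V : Opens (TopCat.of ℝ)}

lemma value_res (h : V ≤ U) (f : Sec (intervalSheaf k I) U) (x : ℝ) (hx : x ∈ V) :
    value k I (res (intervalSheaf k I) h f) x hx = value k I f x (h hx) := rfl

lemma value_ext (f g : Sec (intervalSheaf k I) U)
    (h : ∀ x hx, value k I f x hx = value k I g x hx) : f = g :=
  Subtype.ext (funext fun x => h x.1 x.2)

lemma value_eq_zero (f : Sec (intervalSheaf k I) U) (x : ℝ) (hx : x ∈ U) (h : x ∉ (I : Set ℝ)) :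
    value k I f x hx = 0 :=
  ((f : intervalSections k I U).2 ⟨x, hx⟩).1 h

lemma eventually_value_eq (f : Sec (intervalSheaf k I) U) (x : ℝ) (hx : x ∈ U) :
    ∀ᶠ y in 𝓝 x, ∀ hy : y ∈ U, y ∈ (I : Set ℝ) → value k I f y hy = value k I f x hx := by
  have h := ((f : intervalSections k I U).2 ⟨x, hx⟩).2
  rw [nhds_subtype, Filter.eventually_comap] at h
  exact h.mono fun y hy hyU hyI => hy ⟨y, hyU⟩ rfl hyI

lemma exists_value_eq (v : ℝ → k) (h₀ : ∀ x, x ∉ (I : Set ℝ) → v x = 0)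
    (hv : ∀ x ∈ U, ∀ᶠ y in 𝓝 x, y ∈ (I : Set ℝ) → v y = v x) :
    ∃ f : Sec (intervalSheaf k I) U, ∀ x hx, value k I f x hx = v x := by
  refine ⟨(⟨fun x => v x.1, fun x => ⟨fun hx => h₀ x.1 hx, ?_⟩⟩ : intervalSections k I U),
    fun x hx => rfl⟩
  exact continuous_subtype_val.continuousAt.eventually (hv x.1 x.2)

/-- Near `x`, the values on the bar equal the value at `x`, even when `x` is off the bar; so one
zero value forces a zero germ. -/
lemma germ_eq_zero_iff (f : Sec (intervalSheaf k I) U) (x : ℝ) (hx : x ∈ U) :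
    germ (intervalSheaf k I) U x hx f = 0 ↔ value k I f x hx = 0 := by
  constructor
  · intro h
    obtain ⟨W, hW, h₁, h₂, h⟩ := eventually_germ_eq (intervalSheaf k I) x hx hx f 0
      (by rw [map_zero]; exact h)
    exact (value_res h₁ f x hW).symm.trans (congrArg (fun s => value k I s x hW) h)
  · intro h
    have he : ∀ᶠ y in 𝓝 x, ∀ hy : y ∈ U, value k I f y hy = 0 := by
      filter_upwards [eventually_value_eq f x hx] with y hy hyU
      by_cases hyI : y ∈ (I : Set ℝ)
      · exact (hy hyU hyI).trans h
      · exact value_eq_zero f y hyU hyI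
    obtain ⟨N, hN, hNo, hxN⟩ := eventually_nhds_iff.1 he
    have hz : res (intervalSheaf k I) (inf_le_left : U ⊓ ⟨N, hNo⟩ ≤ U) f = 0 :=
      value_ext _ _ fun y hy => hN y hy.2 hy.1
    rw [← germ_res (intervalSheaf k I) (inf_le_left : U ⊓ ⟨N, hNo⟩ ≤ U) x ⟨hx, hxN⟩ f, hz, map_zero]

lemma germ_eq_iff (f : Sec (intervalSheaf k I) U) (g : Sec (intervalSheaf k I) V) (x : ℝ)
    (hx : x ∈ U) (hx' : x ∈ V) :
    germ (intervalSheaf k I) U x hx f = germ (intervalSheaf k I) V x hx' g ↔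
      value k I f x hx = value k I g x hx' := by
  rw [← germ_res (intervalSheaf k I) (inf_le_left : U ⊓ V ≤ U) x ⟨hx, hx'⟩ f,
    ← germ_res (intervalSheaf k I) (inf_le_right : U ⊓ V ≤ V) x ⟨hx, hx'⟩ g, ← sub_eq_zero,
    ← map_sub]
  refine (germ_eq_zero_iff _ x (⟨hx, hx'⟩ : x ∈ U ⊓ V)).trans ?_
  exact sub_eq_zero (a := value k I f x hx) (b := value k I g x hx')

/-- The segment lies in the bar by convexity and is connected, and the section is locally constant
along it. -/
lemma value_eq_of_Icc_subset (f : Sec (intervalSheaf k I) U) {s t : ℝ} (hst : s ≤ t)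
    (hU : Set.Icc s t ⊆ U) (hs : s ∈ (I : Set ℝ)) (ht : t ∈ (I : Set ℝ)) :
    value k I f s (hU ⟨le_rfl, hst⟩) = value k I f t (hU ⟨hst, le_rfl⟩) := by
  have := isPreconnected_Icc.induction₂ (s := Set.Icc s t)
    (fun x y => ∀ hx hy, value k I f x hx = value k I f y hy) (fun x hx => ?_)
    (fun x y z _ hy _ h₁ h₂ h₃ h₄ => (h₁ h₃ (hU hy)).trans (h₂ (hU hy) h₄))
    (fun x y _ _ h h₁ h₂ => (h h₂ h₁).symm) ⟨le_rfl, hst⟩ ⟨hst, le_rfl⟩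
  · exact this _ _
  · rw [eventually_nhdsWithin_iff]
    filter_upwards [eventually_value_eq f x (hU hx)] with y hy hyst h₁ h₂
    exact (hy h₂ (I.2.2.out hs ht hyst)).symm

/-- Near a point of the bar, the indicator function of the bar is a section. -/
lemma exists_local_section (I : Bar) (y : ℝ) (hy : y ∈ (I : Set ℝ)) :
    ∃ (U : Opens (TopCat.of ℝ)) (hU : y ∈ U) (f : Sec (intervalSheaf k I) U),
      value k I f y hU = 1 := by
  classical
  -- This packs two cases: either `(l, y)` lies in the bar, or the bar has no points below `y`. The
  -- same is done on the right with `u`.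
  obtain ⟨l, hly, hl⟩ : ∃ l < y, ∀ x < y, l < x → x ∉ (I : Set ℝ) → ∀ z < y, z ∉ (I : Set ℝ) := by
    by_cases h : ∃ l < y, l ∈ (I : Set ℝ)
    · obtain ⟨l, hly, hl⟩ := h
      exact ⟨l, hly, fun x hxy hlx hx => absurd (I.2.2.out hl hy ⟨hlx.le, hxy.le⟩) hx⟩
    · exact ⟨y - 1, sub_one_lt y, fun _ _ _ _ z hz hzI => h ⟨z, hz, hzI⟩⟩
  obtain ⟨u, hyu, hu⟩ : ∃ u > y, ∀ x > y, x < u → x ∉ (I : Set ℝ) → ∀ z > y, z ∉ (I : Set ℝ) := by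
    by_cases h : ∃ u > y, u ∈ (I : Set ℝ)
    · obtain ⟨u, hyu, hu⟩ := h
      exact ⟨u, hyu, fun x hxy hxu hx => absurd (I.2.2.out hy hu ⟨hxy.le, hxu.le⟩) hx⟩
    · exact ⟨y + 1, lt_add_one y, fun _ _ _ _ z hz hzI => h ⟨z, hz, hzI⟩⟩
  obtain ⟨f, hf⟩ := exists_value_eq (k := k) (I := I) (U := ⟨Set.Ioo l u, isOpen_Ioo⟩)
    (fun x => if x ∈ (I : Set ℝ) then 1 else 0) (fun x hx => if_neg hx) (fun x hx => by
      by_cases hxI : x ∈ (I : Set ℝ)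
      · exact Filter.Eventually.of_forall fun z hz => by rw [if_pos hz, if_pos hxI]
      · rcases lt_trichotomy x y with hxy | hxy | hxy
        · filter_upwards [Iio_mem_nhds hxy] with z hz hzI
          exact absurd hzI (hl x hxy hx.1 hxI z hz)
        · exact absurd (hxy ▸ hy) hxI
        · filter_upwards [Ioi_mem_nhds hxy] with z hz hzI
          exact absurd hzI (hu x hxy hx.2 hxI z hz))
  have hlyu : y ∈ Set.Ioo l u := ⟨hly, hyu⟩
  exact ⟨_, hlyu, f, (hf y hlyu).trans (if_pos hy)⟩

end

/-! ### Sections of interval sheaves over `γ`-open sets. -/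

section Direct

variable {I : Bar} {W : Opens (TopCat.of GammaReal)}

open Classical in
/-- The family of values of a section of an interval sheaf over a `γ`-open set. -/
def directValue (g : Sec (directImage (intervalSheaf k I)) W) (t : ℝ) : k :=
  if ht : ofReal t ∈ W then value k I (U := (Opens.map psi).obj W) g t ht else 0

lemma directValue_of_mem (g : Sec (directImage (intervalSheaf k I)) W) {t : ℝ} (ht : ofReal t ∈ W) :
    directValue g t = value k I (U := (Opens.map psi).obj W) g t ht :=
  dif_pos ht

lemma Bar.IsLeftContinuous.isCompatibleFamily_directValue (hI : I.IsLeftContinuous)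
    (g : Sec (directImage (intervalSheaf k I)) W) : IsCompatibleFamily I W (directValue g) where
  eq_zero t ht := by
    by_cases hW : ofReal t ∈ W
    · exact (directValue_of_mem g hW).trans (value_eq_zero _ t hW ht)
    · exact dif_neg hW
  eq_of_le s t hst hs ht := by
    rw [directValue_of_mem g hs, directValue_of_mem g (mem_of_le hs hst)]
    by_cases hsI : s ∈ (I : Set ℝ)
    · exact value_eq_of_Icc_subset (U := (Opens.map psi).obj W) g hst
        (fun x hx => mem_of_le hs hx.1) hsI ht
    · have hbdd : ∀ y ∈ (I : Set ℝ), s ≤ y := fun y hy => not_lt.1 fun hys =>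
        hsI (I.2.2.out hy ht ⟨hys.le, hst⟩)
      -- The infimum is off the bar, since the bar has no minimum. The section vanishes at `a`,
      -- hence on the bar just after `a`, and then up to `t` by connectedness.
      set a := sInf (I : Set ℝ)
      have hsa : s ≤ a := le_csInf ⟨t, ht⟩ hbdd
      have haI : a ∉ (I : Set ℝ) := fun ha => by
        obtain ⟨b, hba, hb⟩ := hI.1 a ha
        exact absurd (csInf_le ⟨s, hbdd⟩ hb) (not_le.2 hba)
      have haW : ofReal a ∈ W := mem_of_le hs hsa
      have hat : a < t := lt_of_le_of_ne (csInf_le ⟨s, hbdd⟩ ht) fun h => haI (h ▸ ht)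
      obtain ⟨l, u, hau, hlu⟩ := mem_nhds_iff_exists_Ioo_subset.1
        (eventually_value_eq (U := (Opens.map psi).obj W) g a haW)
      obtain ⟨y, hy, hyu⟩ := exists_lt_of_csInf_lt ⟨t, ht⟩ (lt_min hau.2 hat)
      have hay : a ≤ y := csInf_le ⟨s, hbdd⟩ hy
      have hyW : ofReal y ∈ W := mem_of_le haW hay
      refine (value_eq_zero (U := (Opens.map psi).obj W) g s hs hsI).trans ?_
      refine (value_eq_zero (U := (Opens.map psi).obj W) g a haW haI).symm.trans ?_
      refine (hlu ⟨hau.1.trans_le hay, hyu.trans_le (min_le_left _ _)⟩ hyW hy).symm.trans ?_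
      exact value_eq_of_Icc_subset (U := (Opens.map psi).obj W) g
        (hyu.le.trans (min_le_right _ _)) (fun x hx => mem_of_le hyW hx.1) hy ht

/-- Local constancy could fail only at a point off the bar where the bar accumulates from the left,
and left continuity excludes this. -/
lemma Bar.IsLeftContinuous.exists_directValue_eq (hI : I.IsLeftContinuous) {v : ℝ → k}
    (hv : IsCompatibleFamily I W v) :
    ∃ g : Sec (directImage (intervalSheaf k I)) W, ∀ t (ht : ofReal t ∈ W),
      value k I (U := (Opens.map psi).obj W) g t ht = v t := by
  refine exists_value_eq (U := (Opens.map psi).obj W) v hv.eq_zero fun x hx => ?_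
  by_cases hxI : x ∈ (I : Set ℝ)
  · obtain ⟨c, hcx, hcW⟩ := exists_ray_le (x := x) hx
    filter_upwards [Ioi_mem_nhds hcx] with y hy hyI
    rcases le_total x y with hxy | hxy
    · exact (hv.eq_of_le x y hxy hx hyI).symm
    · exact hv.eq_of_le y x hxy (hcW hy) hxI
  · by_cases h : ∃ y ∈ (I : Set ℝ), y < x
    · obtain ⟨c, hcx, hc⟩ := hI.2 x hxI h
      filter_upwards [Ioi_mem_nhds hcx] with y hy hyI
      exact absurd hyI (hc y hy)
    · refine Filter.Eventually.of_forall fun y hyI => ?_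
      exact (hv.eq_of_le x y (not_lt.1 fun hyx => h ⟨y, hyI, hyx⟩) hx hyI).symm

lemma isLeftContinuous_of_isIso_psiCounit (h : IsIso (psiCounit (intervalSheaf k I))) :
    I.IsLeftContinuous := by
  classical
  obtain ⟨h₁, h₂⟩ := (isIso_psi_counit_iff _).1 h
  -- The indicator germ at `y` extends to a section over a `γ`-open set, equal to `1` on the bar
  -- beyond `y` and to `0` at `t`. If the bar accumulated at `t`, local constancy there would give
  -- `1 = 0`.
  have hR : ∀ t ∉ (I : Set ℝ), (∃ y ∈ (I : Set ℝ), y < t) → ∃ c < t, ∀ s > c, s ∉ (I : Set ℝ) := by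
    rintro t ht ⟨y, hy, hyt⟩
    obtain ⟨U, hU, f, hf⟩ := exists_local_section (k := k) I y hy
    obtain ⟨W, hyW, g, hg⟩ := h₁ y (germ (intervalSheaf k I) U y hU f)
    have hgy := ((germ_eq_iff (U := (Opens.map psi).obj W) g f y hyW hU).1 hg).trans hf
    have htW : ofReal t ∈ W := mem_of_le hyW hyt.le
    by_contra! hcon
    obtain ⟨l, u, htu, hlu⟩ := mem_nhds_iff_exists_Ioo_subset.1
        (eventually_value_eq (U := (Opens.map psi).obj W) g t htW)
    obtain ⟨z, hz, hzI⟩ := hcon (max l y) (max_lt htu.1 hyt)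
    have hzt : z < t := not_le.1 fun htz => ht (I.2.2.out hy hzI ⟨hyt.le, htz⟩)
    have hyz : y < z := (le_max_right _ _).trans_lt hz
    have hzW : ofReal z ∈ W := mem_of_le hyW hyz.le
    have := hlu ⟨(le_max_left _ _).trans_lt hz, hzt.trans htu.2⟩ hzW hzI
    have hyz' := value_eq_of_Icc_subset (U := (Opens.map psi).obj W) g hyz.le
      (fun x hx => mem_of_le hyW hx.1) hy hzI
    exact one_ne_zero (hgy.symm.trans (hyz'.trans (this.trans
      (value_eq_zero (U := (Opens.map psi).obj W) g t htW ht))))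
  refine ⟨fun t ht => ?_, hR⟩
  by_contra! hcon
  -- If `t` were the minimum, the indicator would be a section with zero germ at `t - 1 / 2`, a
  -- point below the bar. Determination by germs would then make it vanish at `t`. Local constancy
  -- beyond the right end comes from `hR`.
  obtain ⟨g, hg⟩ := exists_value_eq (k := k) (I := I) (U := (Opens.map psi).obj (ray (t - 1)))
    (fun x => if x ∈ (I : Set ℝ) then 1 else 0) (fun x hx => if_neg hx) (fun x hx => by
      by_cases hxI : x ∈ (I : Set ℝ)
      · exact Filter.Eventually.of_forall fun z hz => by rw [if_pos hz, if_pos hxI]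
      · rcases lt_trichotomy x t with hxt | hxt | hxt
        · filter_upwards [Iio_mem_nhds hxt] with z hz hzI
          exact absurd hzI (hcon z hz)
        · exact absurd (hxt ▸ ht) hxI
        · obtain ⟨c, hcx, hc⟩ := hR x hxI ⟨t, ht, hxt⟩
          filter_upwards [Ioi_mem_nhds hcx] with z hz hzI
          exact absurd hzI (hc z hz))
  have hm : t - 1 < t - 1 / 2 := by linarith
  have hm' : t - 1 / 2 < t := by linarith
  obtain ⟨c, hc, h⟩ := h₂ (ray (t - 1)) (t - 1 / 2) hm g ((germ_eq_zero_iff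
    (U := (Opens.map psi).obj (ray (t - 1))) g _ hm).2 ((hg _ hm).trans
      (if_neg (hcon _ hm'))))
  have := (germ_eq_zero_iff (U := (Opens.map psi).obj (ray (t - 1))) g t (sub_one_lt t)).1
    (h t (sub_one_lt t) (hc.trans hm'))
  exact one_ne_zero ((if_pos ht).symm.trans ((hg t (sub_one_lt t)).symm.trans this))

lemma Bar.IsLeftContinuous.isIso_psiCounit (hI : I.IsLeftContinuous) :
    IsIso (psiCounit (intervalSheaf k I)) := by
  refine (isIso_psi_counit_iff _).2 ⟨fun x a => ?_, fun W t ht g hg => ?_⟩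
  · obtain ⟨U, hU, f, rfl⟩ := exists_germ_eq (intervalSheaf k I) x a
    obtain ⟨W, v, hxW, hv, hvx⟩ := hI.exists_compatible x (value k I f x hU)
      (value_eq_zero f x hU)
    obtain ⟨g, hg⟩ := hI.exists_directValue_eq hv
    exact ⟨W, hxW, g, (germ_eq_iff (U := (Opens.map psi).obj W) g f x hxW hU).2
      ((hg x hxW).trans hvx)⟩
  · obtain ⟨c, hct, h⟩ := hI.eventually_eq_zero (hI.isCompatibleFamily_directValue g) ht
      ((directValue_of_mem g ht).trans
        ((germ_eq_zero_iff (U := (Opens.map psi).obj W) g t ht).1 hg))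
    exact ⟨c, hct, fun s hs hcs => (germ_eq_zero_iff (U := (Opens.map psi).obj W) g s hs).2
      ((directValue_of_mem g hs).symm.trans (h s hs hcs))⟩

end Direct

end IntervalSheaves

/-! ### Comparison of interval modules and interval sheaves -/

section Comparison

variable {k : Type} [Field k] {I : Bar} (hI : I.IsLeftContinuous)

lemma exists_component_eq_directValue (hI : I.IsLeftContinuous) (W : Opens (TopCat.of GammaReal))
    (g : Sec (directImage (intervalSheaf k I)) W) :
    ∃ g' : Sec ((toGammaSheaf k).obj (intervalModule k I)) W, ∀ t (ht : ofReal t ∈ W),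
      (component (intervalModule k I) W t ht g' : intervalValue k I t).1 =
        value k I (U := (Opens.map psi).obj W) g t ht := by
  obtain ⟨g', hg'⟩ := exists_section_of_isCompatibleFamily k I W
    (hI.isCompatibleFamily_directValue g)
  exact ⟨g', fun t ht => (hg' t ht).trans (directValue_of_mem g ht)⟩

lemma section_ext_of_value (W : Opens (TopCat.of GammaReal))
    (g g' : Sec ((toGammaSheaf k).obj (intervalModule k I)) W)
    (h : ∀ t (ht : ofReal t ∈ W), (component (intervalModule k I) W t ht g : intervalValue k I t).1 =
      (component (intervalModule k I) W t ht g' : intervalValue k I t).1) : g = g' :=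
  component_ext _ W g g' fun t ht => Subtype.ext (h t ht)

/-- A section of the interval sheaf over a `γ`-open set, as a compatible family. -/
def comparisonSec (W : Opens (TopCat.of GammaReal)) :
    Sec (directImage (intervalSheaf k I)) W →ₗ[k]
      Sec ((toGammaSheaf k).obj (intervalModule k I)) W where
  toFun g := (exists_component_eq_directValue hI W g).choose
  map_add' g g' := section_ext_of_value W _ _ fun t ht => by
    rw [(exists_component_eq_directValue hI W (g + g')).choose_spec t ht, map_add]
    exact (congrArg₂ (· + ·) ((exists_component_eq_directValue hI W g).choose_spec t ht)
      ((exists_component_eq_directValue hI W g').choose_spec t ht)).symm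
  map_smul' c g := section_ext_of_value W _ _ fun t ht => by
    rw [(exists_component_eq_directValue hI W (c • g)).choose_spec t ht, map_smul]
    exact (congrArg (c • ·) ((exists_component_eq_directValue hI W g).choose_spec t ht)).symm

lemma component_comparisonSec (W : Opens (TopCat.of GammaReal))
    (g : Sec (directImage (intervalSheaf k I)) W) (t : ℝ) (ht : ofReal t ∈ W) :
    (component (intervalModule k I) W t ht (comparisonSec hI W g) : intervalValue k I t).1 =
      value k I (U := (Opens.map psi).obj W) g t ht :=
  (exists_component_eq_directValue hI W g).choose_spec t ht

/-- The comparison of the sheaves for the `γ`-topology attached to a bar. -/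
def comparison : directImage (intervalSheaf k I) ⟶ (toGammaSheaf k).obj (intervalModule k I) :=
  ⟨{ app := fun W => ModuleCat.ofHom (comparisonSec hI W.unop)
     naturality := fun W W' i => by
      ext g
      refine section_ext_of_value W'.unop _ _ fun t ht => ?_
      refine (component_comparisonSec hI W'.unop _ t ht).trans (Eq.trans ?_ (congrArg Subtype.val
        (component_res (intervalModule k I) i.unop.le t ht (comparisonSec hI W.unop g))).symm)
      exact (component_comparisonSec hI W.unop g t (i.unop.le ht)).symm }⟩

instance isIso_comparison : IsIso (comparison (k := k) hI) := by
  refine isIso_of_secMap_bijective _ fun W => ⟨fun g g' h => ?_, fun g => ?_⟩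
  · refine value_ext (U := (Opens.map psi).obj W) _ _ fun t ht => ?_
    rw [← component_comparisonSec hI W g t ht, ← component_comparisonSec hI W g' t ht]
    exact congrArg (fun a => (component (intervalModule k I) W t ht a : intervalValue k I t).1) h
  · obtain ⟨g', hg'⟩ := hI.exists_directValue_eq (isCompatibleFamily_sectionValue k I W g)
    refine ⟨g', section_ext_of_value W _ _ fun t ht => ?_⟩
    exact (component_comparisonSec hI W g' t ht).trans ((hg' t ht).trans
      (sectionValue_of_mem k I W g ht))

end Comparison

/-! ### Transport of barcodes -/

section Transport

variable {k : Type} [Field k]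

/-- The functor from sheaves for the `γ`-topology preserves all colimits. -/
instance : (ofGammaSheaf k).IsLeftAdjoint := (gammaAdjunction k).isLeftAdjoint

variable {ι : Type} (J : ι → Bar)

/-- A direct sum of interval sheaves for the `γ`-topology. -/
abbrev gammaSum : TopCat.Sheaf (ModuleCat.{0} k) (TopCat.of GammaReal) :=
  ∐ fun i => (toGammaSheaf k).obj (intervalModule k (J i))

variable {J} (hJ : ∀ i, (J i).IsLeftContinuous)

/-- The functor attached to a direct sum of interval sheaves for the `γ`-topology. -/
def ofGammaSum : (ofGammaSheaf k).obj (gammaSum J) ≅ ∐ fun i => intervalModule k (J i) :=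
  (PreservesCoproduct.iso (ofGammaSheaf k) _).trans
    (Limits.Sigma.mapIso fun i =>
      haveI := (isIso_counit_intervalModule_iff k (J i)).2 (hJ i)
      asIso ((gammaAdjunction k).counit.app (intervalModule k (J i))))

/-- The inverse image of a direct sum of interval sheaves for the `γ`-topology. -/
def inverseImageGammaSum : inverseImage psi (gammaSum (k := k) J) ≅ ∐ fun i => intervalSheaf k (J i) :=
  (PreservesCoproduct.iso (TopCat.Sheaf.pullback (ModuleCat.{0} k) psi) _).trans
    (Limits.Sigma.mapIso fun i =>
      haveI := (hJ i).isIso_psiCounit (k := k)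
      ((TopCat.Sheaf.pullback (ModuleCat.{0} k) psi).mapIso (asIso (comparison (hJ i))).symm).trans
        (asIso (psiCounit (intervalSheaf k (J i)))))

/-- `Φ` maps direct sums of interval modules to direct sums of interval sheaves. -/
def phiSum : (Phi k).obj (∐ fun i => intervalModule k (J i)) ≅ ∐ fun i => intervalSheaf k (J i) :=
  -- The right adjoint `toGammaSheaf` is not required to preserve the coproduct: the sum is
  -- rewritten as the image of `gammaSum` under the left adjoint, and the unit cancels the two
  -- functors.
  ((TopCat.Sheaf.pullback (ModuleCat.{0} k) psi).mapIso
    (((toGammaSheaf k).mapIso (ofGammaSum hJ).symm).trans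
      (asIso ((gammaAdjunction k).unit.app (gammaSum J))).symm)).trans (inverseImageGammaSum hJ)

/-- `Ψ` maps direct sums of interval sheaves to direct sums of interval modules. -/
def psiSum : (Psi k).obj (∐ fun i => intervalSheaf k (J i)) ≅ ∐ fun i => intervalModule k (J i) :=
  ((ofGammaSheaf k).mapIso
    (((TopCat.Sheaf.pushforward (ModuleCat.{0} k) psi).mapIso (inverseImageGammaSum hJ).symm).trans
      (asIso ((TopCat.Sheaf.pullbackPushforwardAdjunction (ModuleCat.{0} k) psi).unit.app
        (gammaSum J))).symm)).trans (ofGammaSum hJ)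

end Transport

/-! ### All bars of an object of the two categories have the same type -/

section Retracts

variable {k : Type} [Field k]

/-- By naturality, the counit at `X` is a retract of the counit at `Y` in the arrow category. -/
lemma isIso_counit_of_retract {C D : Type*} [Category C] [Category D] {L : C ⥤ D} {R : D ⥤ C}
    (adj : L ⊣ R) {X Y : D} (r : Retract X Y) [IsIso (adj.counit.app Y)] :
    IsIso (adj.counit.app X) :=
  MorphismProperty.of_retract (P := MorphismProperty.isomorphisms D)
    (NatTrans.retractArrowApp adj.counit r) (inferInstanceAs (IsIso (adj.counit.app Y)))

/-- The summands of a coproduct are retracts of it. -/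
def retractSigma {C : Type*} [Category C] [HasZeroMorphisms C] {ι : Type*} [DecidableEq ι]
    (f : ι → C) [HasCoproduct f] (i : ι) : Retract (f i) (∐ f) where
  i := Sigma.ι f i
  r := Sigma.π f i

/-- All bars of a barcode are left continuous. -/
def Barcode.IsLeftContinuous (B : Barcode) : Prop := ∀ I, B I ≠ 0 → I.IsLeftContinuous

lemma Barcode.IsLeftContinuous.bar {B : Barcode} (hB : B.IsLeftContinuous)
    (p : Σ I : Bar, Fin (B I)) : p.1.IsLeftContinuous :=
  hB p.1 (Nat.pos_iff_ne_zero.1 p.2.pos)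

instance : (ofGammaSheaf k).Full := (gammaAdjunction k).fullyFaithfulLOfIsIsoUnit.full

instance : (ofGammaSheaf k).Faithful := (gammaAdjunction k).fullyFaithfulLOfIsIsoUnit.faithful

instance : (TopCat.Sheaf.pullback (ModuleCat.{0} k) psi).Full :=
  (TopCat.Sheaf.pullbackPushforwardAdjunction (ModuleCat.{0} k) psi).fullyFaithfulLOfIsIsoUnit.full

instance : (TopCat.Sheaf.pullback (ModuleCat.{0} k) psi).Faithful :=
  (TopCat.Sheaf.pullbackPushforwardAdjunction (ModuleCat.{0} k) psi).fullyFaithfulLOfIsIsoUnit.faithful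

variable {V : ℝ ⥤ ModuleCat.{0} k} {F : TopCat.Sheaf (ModuleCat.{0} k) (TopCat.of ℝ)} {B : Barcode}

/-- `V` lies in the essential image of the fully faithful left adjoint, where the counit is
invertible. -/
lemma HasBarcode.isIso_counit (h : HasBarcode V B) (hB : B.IsLeftContinuous) :
    IsIso ((gammaAdjunction k).counit.app V) :=
  (gammaAdjunction k).isIso_counit_app_of_iso (h.some.trans (ofGammaSum hB.bar).symm)

lemma HasSheafBarcode.isIso_counit (h : HasSheafBarcode F B) (hB : B.IsLeftContinuous) :
    IsIso ((TopCat.Sheaf.pullbackPushforwardAdjunction (ModuleCat.{0} k) psi).counit.app F) :=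
  (TopCat.Sheaf.pullbackPushforwardAdjunction (ModuleCat.{0} k) psi).isIso_counit_app_of_iso
    (h.some.trans (inverseImageGammaSum hB.bar).symm)

-- Each bar is a retract of `V`, so it inherits an invertible counit and the interval criterion
-- applies.
open Classical in
lemma HasBarcode.isLeftContinuous [IsIso ((gammaAdjunction k).counit.app V)] (h : HasBarcode V B) :
    B.IsLeftContinuous := fun I hI => by
  rw [← isIso_counit_intervalModule_iff k]
  exact isIso_counit_of_retract (gammaAdjunction k)
    ((retractSigma (fun p : Σ I : Bar, Fin (B I) => intervalModule k p.1)
      ⟨I, 0, Nat.pos_of_ne_zero hI⟩).trans (Retract.ofIso h.some.symm))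

open Classical in
lemma HasSheafBarcode.isLeftContinuous
    [IsIso ((TopCat.Sheaf.pullbackPushforwardAdjunction (ModuleCat.{0} k) psi).counit.app F)]
    (h : HasSheafBarcode F B) : B.IsLeftContinuous := fun I hI =>
  isLeftContinuous_of_isIso_psiCounit (k := k) (isIso_counit_of_retract
    (TopCat.Sheaf.pullbackPushforwardAdjunction (ModuleCat.{0} k) psi)
    ((retractSigma (fun p : Σ I : Bar, Fin (B I) => intervalSheaf k p.1)
      ⟨I, 0, Nat.pos_of_ne_zero hI⟩).trans (Retract.ofIso h.some.symm)))

lemma HasBarcode.phi (h : HasBarcode V B) (hB : B.IsLeftContinuous) :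
    HasSheafBarcode ((Phi k).obj V) B :=
  ⟨((Phi k).mapIso h.some).trans (phiSum hB.bar)⟩

lemma HasSheafBarcode.psi (h : HasSheafBarcode F B) (hB : B.IsLeftContinuous) :
    HasBarcode ((Psi k).obj F) B :=
  ⟨((Psi k).mapIso h.some).trans (psiSum hB.bar)⟩

end Retracts

/-! ### Constructibility -/

section Constructible

variable {k : Type} [Field k]

lemma IsPersistenceModule.of_iso {V V' : ℝ ⥤ ModuleCat.{0} k} (e : V ≅ V')
    (h : IsPersistenceModule V) : IsPersistenceModule V' where
  finite t := by
    have := h.finite t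
    exact Module.Finite.equiv (e.app t).toLinearEquiv
  regular := by
    have : spectrum V' = spectrum V := Set.ext fun t => not_congr (exists_congr fun U =>
      and_congr_right fun _ => forall₅_congr fun s _ r _ h =>
        (NatIso.isIso_map_iff e (homOfLE h)).symm)
    rw [this]
    exact h.regular

lemma isIso_germ_iff {X : TopCat.{0}} (F : X.Sheaf (ModuleCat.{0} k)) (U : Opens X) (x : X) (hx : x ∈ U) :
    IsIso (F.presheaf.germ U x hx) ↔ Function.Bijective (germ F U x hx) :=
  ConcreteCategory.isIso_iff_bijective _

lemma IsConstructible.of_iso {F F' : TopCat.Sheaf (ModuleCat.{0} k) (TopCat.of ℝ)} (e : F ≅ F')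
    (h : IsConstructible F) : IsConstructible F' where
  finite x := by
    have := h.finite x
    exact Module.Finite.equiv (LinearEquiv.ofBijective _ (stalkMap_bijective e.hom x))
  locallyConstant := by
    obtain ⟨S, hS, h⟩ := h.locallyConstant
    refine ⟨S, hS, fun x hx => ?_⟩
    obtain ⟨U, hxU, hU⟩ := h x hx
    refine ⟨U, hxU, fun y hy => (isIso_germ_iff F' U y hy).2 ?_⟩
    have hc : germ F' U y hy ∘ secMap e.hom U = stalkMap e.hom y ∘ germ F U y hy :=
      funext fun s => (stalkMap_germ e.hom U y hy s).symm
    refine (Function.Bijective.of_comp_iff _ (secMap_bijective e.hom U)).1 ?_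
    rw [hc]
    exact (stalkMap_bijective e.hom y).comp ((isIso_germ_iff F U y hy).1 (hU y hy))

variable (G : TopCat.Sheaf (ModuleCat.{0} k) (TopCat.of GammaReal))

/-- The stalks of `ψ⁻¹G` are the values of the functor attached to `G`. -/
def stalkEquiv (x : ℝ) :
    Stalk (inverseImage psi G) x ≃ₗ[k] ((ofGammaSheaf k).obj G).obj x :=
  (LinearEquiv.ofBijective (toStalk G x) (stalkUnit_bijective psi G x)).symm.trans (valueEquiv G x)

lemma stalkEquiv_toStalk (x : ℝ) (a : Stalk G (ofReal x)) :
    stalkEquiv G x (toStalk G x a) = valueEquiv G x a :=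
  congrArg (valueEquiv G x)
    ((LinearEquiv.ofBijective (toStalk G x) (stalkUnit_bijective psi G x)).symm_apply_apply a)

/-- The interval `(c, e)` is an initial part of the ray `(c, ∞)`, so
`exists_section_of_inverseImage` applies. -/
lemma exists_section_of_Ioo {U : Opens (TopCat.of ℝ)} {c e : ℝ} (hce : c < e)
    (hU : ∀ x : ℝ, c < x → x < e → x ∈ U) (h : Sec (inverseImage psi G) U) :
    ∃ g : Sec G (ray c), ∀ (x : ℝ) (h₁ : c < x) (h₂ : x < e),
      stalkEquiv G x (germ (inverseImage psi G) U x (hU x h₁ h₂) h) =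
        valueEquiv G x (germAt G (ray c) x h₁ g) := by
  have hle : (⟨Set.Ioo c e, isOpen_Ioo⟩ : Opens (TopCat.of ℝ)) ≤ U := fun x hx => hU x hx.1 hx.2
  obtain ⟨g, hg⟩ := exists_section_of_inverseImage G
    (U := (⟨Set.Ioo c e, isOpen_Ioo⟩ : Opens (TopCat.of ℝ))) (W := ray c) (fun x hx => hx.1)
    (fun x y hx hyx hy => ⟨hy, hyx.trans_lt hx.2⟩) (fun x hx => by
      obtain ⟨y, hy, hy'⟩ := exists_between (lt_min hx hce)
      exact ⟨y, ⟨hy, hy'.trans_le (min_le_right _ _)⟩, (hy'.trans_le (min_le_left _ _)).le⟩)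
    (res (inverseImage psi G) hle h)
  refine ⟨g, fun x h₁ h₂ => ?_⟩
  rw [← stalkEquiv_toStalk, ← hg x ⟨h₁, h₂⟩]
  exact congrArg (stalkEquiv G x) (germ_res _ hle x ⟨h₁, h₂⟩ h).symm

lemma exists_section_of_bijective {V : ℝ ⥤ ModuleCat.{0} k} {c y : ℝ} (hcy : c < y)
    (hV : ∀ (s r : ℝ) (h : s ≤ r), c < s → r ≤ y → Function.Bijective (V.map (homOfLE h)))
    (v : V.obj y) :
    ∃ g : Sec ((toGammaSheaf k).obj V) (ray c), component V (ray c) y hcy g = v := by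
  -- The family at `t` is built by lifting `v` back to `min t y` and pushing it forward to `t`,
  -- which treats both sides of `y` at once.
  have hw : ∀ t, c < t → ∃ w : V.obj (min t y), V.map (homOfLE (min_le_right t y)) w = v :=
    fun t ht => (hV _ _ _ (lt_min ht hcy) le_rfl).2 v
  choose w hw using hw
  have hcomp : ∀ {p q r : ℝ} (h₁ : p ≤ q) (h₂ : q ≤ r) (x : V.obj p),
      V.map (homOfLE h₂) (V.map (homOfLE h₁) x) = V.map (homOfLE (h₁.trans h₂)) x :=
    fun h₁ h₂ x => (ConcreteCategory.congr_hom (V.map_comp (homOfLE h₁) (homOfLE h₂)) x).symm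
  obtain ⟨g, hg⟩ := exists_component_eq V (ray c)
    (fun t ht => V.map (homOfLE (min_le_left t y)) (w t ht)) (fun s t hst hs ht => by
      have hmin : min s y ≤ min t y := min_le_min_right y hst
      have : V.map (homOfLE hmin) (w s hs) = w t ht := by
        refine (hV _ _ (min_le_right t y) (lt_min ht hcy) le_rfl).1 ?_
        exact (hcomp _ _ _).trans ((hw s hs).trans (hw t ht).symm)
      refine (hcomp _ _ _).trans ?_
      rw [← this]
      exact (hcomp hmin (min_le_left t y) (w s hs)).symm)
  refine ⟨g, (hg y hcy).trans ?_⟩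
  exact hw y hcy

lemma isConstructible_inverseImage (h : IsPersistenceModule ((ofGammaSheaf k).obj G)) :
    IsConstructible (inverseImage psi G) where
  finite x := by
    have := h.finite x
    exact Module.Finite.equiv (stalkEquiv G x).symm
  locallyConstant := by
    refine ⟨_, h.regular, fun x hx => ?_⟩
    obtain ⟨N, hN, hiso⟩ := not_not.1 hx
    obtain ⟨c, e, hx, hce⟩ := mem_nhds_iff_exists_Ioo_subset.1 hN
    -- Off the spectrum, invertible transfer maps on `(c, e)` let a single value determine a section
    -- there and let every value extend to one.
    have hV : ∀ (s r : ℝ) (h : s ≤ r), c < s → r < e →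
        Function.Bijective (((ofGammaSheaf k).obj G).map (homOfLE h)) := fun s r h hs hr =>
      (ConcreteCategory.isIso_iff_bijective _).1
        (hiso s (hce ⟨hs, h.trans_lt hr⟩) r (hce ⟨hs.trans_le h, hr⟩) h)
    refine ⟨⟨Set.Ioo c e, isOpen_Ioo⟩, hx, fun y hy => (isIso_germ_iff _ _ _ _).2 ⟨?_, fun a => ?_⟩⟩
    · refine (injective_iff_map_eq_zero _).2 fun f hf => section_ext _ _ _ fun s hs => ?_
      obtain ⟨g, hg⟩ := exists_section_of_Ioo G (U := ⟨Set.Ioo c e, isOpen_Ioo⟩) (hx.1.trans hx.2)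
        (fun x h₁ h₂ => ⟨h₁, h₂⟩) f
      have hgy : valueEquiv G y (germAt G (ray c) y hy.1 g) = 0 := by
        rw [← hg y hy.1 hy.2, ← map_zero (stalkEquiv G y)]
        exact congrArg (stalkEquiv G y) hf
      have hgs : valueEquiv G s (germAt G (ray c) s hs.1 g) = 0 := by
        rcases le_total s y with hsy | hsy
        · refine (hV s y hsy hs.1 hy.2).1 ?_
          exact (map_valueEquiv_germAt G (ray c) hsy hs.1 g).trans (hgy.trans (map_zero _).symm)
        · have := map_valueEquiv_germAt G (ray c) hsy hy.1 g
          rw [hgy, map_zero] at this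
          exact this.symm
      rw [map_zero]
      refine (stalkEquiv G s).injective ?_
      rw [map_zero]
      exact (hg s hs.1 hs.2).trans hgs
    · obtain ⟨g', hg'⟩ := exists_section_of_bijective hy.1
        (fun s r h hs hr => hV s r h hs (hr.trans_lt hy.2)) (stalkEquiv G y a)
      obtain ⟨g, rfl⟩ := (secMap_bijective ((gammaAdjunction k).unit.app G) (ray c)).2 g'
      have hle : (⟨Set.Ioo c e, isOpen_Ioo⟩ : Opens (TopCat.of ℝ)) ≤ (Opens.map psi).obj (ray c) :=
        fun x hx => hx.1
      refine ⟨res (inverseImage psi G) hle (unitSec psi G (ray c) g), ?_⟩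
      refine (germ_res (inverseImage psi G) hle y hy _).trans ?_
      refine (toStalk_germAt G (ray c) y hy.1 g).symm.trans ((stalkEquiv G y).injective ?_)
      rw [stalkEquiv_toStalk, ← hg']
      exact (component_unit G (ray c) y hy.1 g).symm

lemma isPersistenceModule_ofGammaSheaf (h : IsConstructible (inverseImage psi G)) :
    IsPersistenceModule ((ofGammaSheaf k).obj G) where
  finite x := by
    have := h.finite x
    exact Module.Finite.equiv (stalkEquiv G x)
  regular := by
    obtain ⟨S, hS, h⟩ := h.locallyConstant
    refine fun a b => (hS a b).subset (Set.inter_subset_inter_left _ fun x hx => ?_)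
    by_contra hxS
    obtain ⟨U, hxU, hU⟩ := h x hxS
    obtain ⟨c, e, hx', hce⟩ := mem_nhds_iff_exists_Ioo_subset.1 (U.isOpen.mem_nhds hxU)
    have hb := fun (y : ℝ) (hy : y ∈ Set.Ioo c e) =>
      (isIso_germ_iff (inverseImage psi G) U y (hce hy)).1 (hU y (hce hy))
    -- Each vector at `y` is the value of a section over `U`, and on `(c, e)` that section comes
    -- from `G`. Transfer maps then carry one germ of this section to another, so they inherit
    -- bijectivity from the germ maps.
    have hlift : ∀ (y : ℝ) (hy : y ∈ Set.Ioo c e) (v : ((ofGammaSheaf k).obj G).obj y),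
        ∃ (f : Sec (inverseImage psi G) U) (g : Sec G (ray c)),
          (∀ (x : ℝ) (hx : x ∈ Set.Ioo c e), stalkEquiv G x
            (germ (inverseImage psi G) U x (hce hx) f) =
              valueEquiv G x (germAt G (ray c) x hx.1 g)) ∧
          valueEquiv G y (germAt G (ray c) y hy.1 g) = v := by
      intro y hy v
      obtain ⟨a, rfl⟩ := (stalkEquiv G y).surjective v
      obtain ⟨f, rfl⟩ := (hb y hy).2 a
      obtain ⟨g, hg⟩ := exists_section_of_Ioo G (hx'.1.trans hx'.2) (fun x h₁ h₂ => hce ⟨h₁, h₂⟩) f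
      exact ⟨f, g, fun x hx => hg x hx.1 hx.2, (hg y hy.1 hy.2).symm⟩
    refine hx ⟨Set.Ioo c e, Ioo_mem_nhds hx'.1 hx'.2, fun s hs r hr hsr =>
      (ConcreteCategory.isIso_iff_bijective _).2 ⟨?_, fun v => ?_⟩⟩
    · refine (injective_iff_map_eq_zero (((ofGammaSheaf k).obj G).map (homOfLE hsr)).hom).2
        fun v hv => ?_
      obtain ⟨f, g, hfg, rfl⟩ := hlift s hs v
      have hz : valueEquiv G r (germAt G (ray c) r hr.1 g) = 0 :=
        (map_valueEquiv_germAt G (ray c) hsr hs.1 g).symm.trans hv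
      have hf : f = 0 := by
        refine (hb r hr).1 ((stalkEquiv G r).injective ?_)
        rw [hfg r hr, hz, map_zero, map_zero]
      rw [← hfg s hs, hf, map_zero, map_zero]
    · obtain ⟨f, g, hfg, rfl⟩ := hlift r hr v
      exact ⟨_, map_valueEquiv_germAt G (ray c) hsr hs.1 g⟩

end Constructible

/-! ### The equivalence -/

section Equivalence

variable (k : Type) [Field k]

/-- The adjunction between inverse and direct images for `ψ`. -/
abbrev psiAdjunction : TopCat.Sheaf.pullback (ModuleCat.{0} k) psi ⊣
    TopCat.Sheaf.pushforward (ModuleCat.{0} k) psi :=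
  TopCat.Sheaf.pullbackPushforwardAdjunction (ModuleCat.{0} k) psi

variable {k}

lemma persistenceModules.exists_barcode {V : ℝ ⥤ ModuleCat.{0} k} (hV : persistenceModules k V) :
    ∃ B : Barcode, HasBarcode V B ∧ B.IsLeftContinuous := by
  obtain ⟨-, B, hB, h⟩ := hV
  exact ⟨B, hB, fun I hI => I.isLeftOpenRightClosed_iff.1 (h I hI)⟩

lemma constructibleSheaves.exists_barcode {F : TopCat.Sheaf (ModuleCat.{0} k) (TopCat.of ℝ)}
    (hF : constructibleSheaves k F) : ∃ B : Barcode, HasSheafBarcode F B ∧ B.IsLeftContinuous := by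
  obtain ⟨-, B, hB, h⟩ := hF
  exact ⟨B, hB, fun I hI => I.isLeftOpenRightClosed_iff.1 (h I hI)⟩

lemma persistenceModules.isIso_counit {V : ℝ ⥤ ModuleCat.{0} k} (hV : persistenceModules k V) :
    IsIso ((gammaAdjunction k).counit.app V) := by
  obtain ⟨B, h, hB⟩ := exists_barcode hV
  exact h.isIso_counit hB

lemma constructibleSheaves.isIso_counit {F : TopCat.Sheaf (ModuleCat.{0} k) (TopCat.of ℝ)}
    (hF : constructibleSheaves k F) : IsIso ((psiAdjunction k).counit.app F) := by
  obtain ⟨B, h, hB⟩ := exists_barcode hF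
  exact h.isIso_counit hB

lemma persistenceModules.phi {V : ℝ ⥤ ModuleCat.{0} k} (hV : persistenceModules k V) :
    constructibleSheaves k ((Phi k).obj V) := by
  obtain ⟨B, h, hB⟩ := exists_barcode hV
  have := isIso_counit hV
  exact ⟨isConstructible_inverseImage ((toGammaSheaf k).obj V)
    (hV.1.of_iso (asIso ((gammaAdjunction k).counit.app V)).symm),
    B, h.phi hB, fun I hI => I.isLeftOpenRightClosed_iff.2 (hB I hI)⟩

lemma constructibleSheaves.psi {F : TopCat.Sheaf (ModuleCat.{0} k) (TopCat.of ℝ)}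
    (hF : constructibleSheaves k F) : persistenceModules k ((Psi k).obj F) := by
  obtain ⟨B, h, hB⟩ := exists_barcode hF
  have := isIso_counit hF
  exact ⟨isPersistenceModule_ofGammaSheaf (directImage F)
    (hF.1.of_iso (asIso ((psiAdjunction k).counit.app F)).symm),
    B, h.psi hB, fun I hI => I.isLeftOpenRightClosed_iff.2 (hB I hI)⟩

variable (k)

/-- `Φ` between the two full subcategories. -/
abbrev phiRestrict : (persistenceModules k).FullSubcategory ⥤ (constructibleSheaves k).FullSubcategory :=
  (constructibleSheaves k).lift ((persistenceModules k).ι ⋙ Phi k) fun V => V.property.phi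

/-- `Ψ` between the two full subcategories. -/
abbrev psiRestrict : (constructibleSheaves k).FullSubcategory ⥤ (persistenceModules k).FullSubcategory :=
  (persistenceModules k).lift ((constructibleSheaves k).ι ⋙ Psi k) fun F => F.property.psi

instance : IsIso (Functor.whiskerLeft (persistenceModules k).ι (gammaAdjunction k).counit) :=
  have (V : (persistenceModules k).FullSubcategory) :
      IsIso ((Functor.whiskerLeft (persistenceModules k).ι (gammaAdjunction k).counit).app V) :=
    V.property.isIso_counit
  NatIso.isIso_of_isIso_app _

instance : IsIso (Functor.whiskerLeft (constructibleSheaves k).ι (psiAdjunction k).counit) :=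
  have (F : (constructibleSheaves k).FullSubcategory) :
      IsIso ((Functor.whiskerLeft (constructibleSheaves k).ι (psiAdjunction k).counit).app F) :=
    F.property.isIso_counit
  NatIso.isIso_of_isIso_app _

/-- `Ψ Φ V` is naturally isomorphic to `V`. -/
def psiPhiIso : 𝟭 (persistenceModules k).FullSubcategory ≅ phiRestrict k ⋙ psiRestrict k :=
  Functor.fullyFaithfulCancelRight (persistenceModules k).ι
    ((asIso (Functor.whiskerLeft (persistenceModules k).ι (gammaAdjunction k).counit)).symm.trans
      (Functor.isoWhiskerLeft ((persistenceModules k).ι ⋙ toGammaSheaf k)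
        (Functor.isoWhiskerRight (asIso (psiAdjunction k).unit) (ofGammaSheaf k))))

/-- `Φ Ψ F` is naturally isomorphic to `F`. -/
def phiPsiIso : psiRestrict k ⋙ phiRestrict k ≅ 𝟭 (constructibleSheaves k).FullSubcategory :=
  Functor.fullyFaithfulCancelRight (constructibleSheaves k).ι
    ((Functor.isoWhiskerLeft ((constructibleSheaves k).ι ⋙ TopCat.Sheaf.pushforward _ psi)
        (Functor.isoWhiskerRight (asIso (gammaAdjunction k).unit)
          (TopCat.Sheaf.pullback _ psi))).symm.trans
      (asIso (Functor.whiskerLeft (constructibleSheaves k).ι (psiAdjunction k).counit)))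

end Equivalence

end PersistenceSheaf

end

open PersistenceSheaf

theorem mainTheorem11 (k : Type) [Field k] :
    ∃ (hPhi : ∀ V : (PersistenceSheaf.persistenceModules k).FullSubcategory,
        PersistenceSheaf.constructibleSheaves k ((PersistenceSheaf.Phi k).obj V.obj))
      (hPsi : ∀ F : (PersistenceSheaf.constructibleSheaves k).FullSubcategory,
        PersistenceSheaf.persistenceModules k ((PersistenceSheaf.Psi k).obj F.obj))
      (e : (PersistenceSheaf.persistenceModules k).FullSubcategory ≌
        (PersistenceSheaf.constructibleSheaves k).FullSubcategory),
      e.functor = (PersistenceSheaf.constructibleSheaves k).lift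
        ((PersistenceSheaf.persistenceModules k).ι ⋙ PersistenceSheaf.Phi k) hPhi ∧
      e.inverse = (PersistenceSheaf.persistenceModules k).lift
        ((PersistenceSheaf.constructibleSheaves k).ι ⋙ PersistenceSheaf.Psi k) hPsi ∧
      (∀ V : (PersistenceSheaf.persistenceModules k).FullSubcategory,
        ∀ B : PersistenceSheaf.Barcode,
          PersistenceSheaf.HasBarcode V.obj B ↔
            PersistenceSheaf.HasSheafBarcode ((PersistenceSheaf.Phi k).obj V.obj) B) ∧
      (∀ F : (PersistenceSheaf.constructibleSheaves k).FullSubcategory,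
        ∀ B : PersistenceSheaf.Barcode,
          PersistenceSheaf.HasBarcode ((PersistenceSheaf.Psi k).obj F.obj) B ↔
            PersistenceSheaf.HasSheafBarcode F.obj B) := by
  refine ⟨fun V => V.property.phi, fun F => F.property.psi,
    CategoryTheory.Equivalence.mk (phiRestrict k) (psiRestrict k) (psiPhiIso k) (phiPsiIso k),
    rfl, rfl, fun V B => ⟨fun h => ?_, fun h => ?_⟩, fun F B => ⟨fun h => ?_, fun h => ?_⟩⟩
  -- The barcode `B` is arbitrary; the invertible counit forces its bars to be left continuous
  -- before they are transported.
  · have := V.property.isIso_counit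
    exact h.phi h.isLeftContinuous
  -- A barcode of $\Phi V$ is carried to $\Psi\Phi V$ and then to `V` by `psiPhiIso`.
  · have := V.property.phi.isIso_counit
    exact ⟨(((persistenceModules k).ι.mapIso ((psiPhiIso k).app V)).trans
      (h.psi h.isLeftContinuous).some)⟩
  · have := F.property.psi.isIso_counit
    exact ⟨((constructibleSheaves k).ι.mapIso ((phiPsiIso k).app F)).symm.trans
      (h.phi h.isLeftContinuous).some⟩
  · have := F.property.isIso_counit
    exact h.psi h.isLeftContinuous
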